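/- Let $d\ge 1$ and let $\mathcal{I}$ be the set of finite tuples of positive integers. On a probability space, let $\mathcal{Z}(u)=\sum_{j=1}^{N(u)}\delta_{X_j(u)}$, $u\in\mathcal{I}$, be independent and identically distributed point processes on $\mathbb{R}^d$, where $N(u)\in\{0,1,2,\ldots\}\cup\{\infty\}$ and the families $(N(u),X_1(u),X_2(u),\ldots)$, $u \in \mathcal{I}$, are independent (that is, the enumeration of the points of $\mathcal{Z}(u)$ carries no information about the other individuals). Let $\mu$ be the common intensity measure, $\mu(A)=\mathbb{E}[\mathcal{Z}(\varnothing)(A)]$. The associated branching random walk has generations $\mathcal{G}_0=\{\varnothing\}$, $\mathcal{G}_{n+1}=\{uj: u\in\mathcal{G}_n,\ j \in \mathbb{N},\ 1\le j\le N(u)\}$, and positions $S(\varnothing)=0$, $S(uj)=S(u)+X_j(u)$. Suppose it is supercritical, i.e. $\mu(\mathbb{R}^d)=\mathbb{E}[N(\varnothing)]\in(1,\infty]$. For $\lambda\in\mathbb{C}^d$ and $x \in \mathbb{R}^d$ write $\lambda x=\sum_i\lambda_i x_i$. Let $\mathcal{D}$ be the set of those $\lambda\in\mathbb{C}^d$ for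 which $m(\lambda)=\int e^{-\lambda x}\,\mu(\mathrm{d}x)$ converges absolutely, and suppose that $\mathcal{D}$ has non-empty interior in $\mathbb{C}^d$. Fix $\lambda\in\mathcal{D}$ with $m(\lambda)\ne 0$, and put $$L(u)=m(\lambda)^{-n}e^{-\lambda S(u)}\quad (u\in\mathcal{G}_n),\qquad Z_n=Z_n(\lambda)=\sum_{u\in\mathcal{G}_n}L(u),\qquad n\ge 0.$$ Suppose that $\mathbb{P}(Z_1=1)<1$, and that for some $\alpha\in(1,2)$: (C1) $\mathbb{E}\big[\sum_{u\in\mathcal{G}_1}|L(u)|^\alpha\big]=1$ and $\mathbb{E}\big[\sum_{u\in\mathcal{G}_1}|L(u)|^\alpha\log|L(u)|\big]\le 0$; (C2) $\mathbb{E}\big[|Z_1|^\alpha\log_+^{2+\varepsilon}|Z_1|\big]<\infty$ for some $\varepsilon>0$. Then there is a complex random variable $Z$ such that $Z_n\to Z$ almost surely, and for every $p\in(0,\alpha)$ all $Z_n$ and $Z$ belong to $L^p$ and $Z_n\to Z$ in $L^p$. Moreover $Z$ is non-degenerate, i.e. not almost surely equal to a constant. -/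

import Mathlib

open MeasureTheory ProbabilityTheory Filter Topology
open scoped ENNReal

noncomputable section

namespace BRW

/-- The Euclidean space `ℝ^d`. -/
abbrev RSpace (d : ℕ) : Type := EuclideanSpace ℝ (Fin d)

/-- The space `ℂ^d` of complex parameters. -/
abbrev CSpace (d : ℕ) : Type := EuclideanSpace ℂ (Fin d)

/-- The bilinear pairing `lam x = ∑ i, lam_i x_i` of `lam ∈ ℂ^d` and `x ∈ ℝ^d`. -/
def pairing {d : ℕ} (lam : CSpace d) (x : RSpace d) : ℂ :=
  ∑ i, lam i * (x i : ℂ)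

/-- The counting measure `∑_{j < N} δ_{x_j}` of the first `N` (possibly infinitely many) terms of
a sequence of points. Labels start at `0`. -/
def pointMeasure {d : ℕ} (N : ℕ∞) (x : ℕ → RSpace d) : Measure (RSpace d) :=
  Measure.sum fun j : {j : ℕ // (j : ℕ∞) < N} => Measure.dirac (x j)

end BRW

/-- A branching random walk on `ℝ^d`, defined on `(Ω, P)`. Individuals are finite words over `ℕ`,
stored with the youngest letter first: the ancestor is `[]` and the `j`-th child of `u` is `j :: u`.
The individual `u` has `N u ∈ {0, 1, …, ∞}` children, and `X u j` (for `j < N u`) is the displacement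
of its `j`-th child. The point processes `∑_{j < N u} δ_{X u j}` are independent and
identically distributed; independence is required together with the enumeration of the points (so
that the enumeration of the children of `u` carries no information about other individuals). -/
structure BranchingRandomWalk (d : ℕ) {Ω : Type*} [MeasurableSpace Ω] (P : Measure Ω) where
  N : List ℕ → Ω → ℕ∞
  X : List ℕ → ℕ → Ω → BRW.RSpace d
  measurable_N : ∀ u, Measurable (N u)
  measurable_X : ∀ u j, Measurable (X u j)
  indep : iIndepFun (fun (u : List ℕ) (ω : Ω) => (N u ω, fun j : ℕ => X u j ω)) P
  identDistrib : ∀ u : List ℕ,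
    IdentDistrib (fun ω => BRW.pointMeasure (N u ω) fun j => X u j ω)
      (fun ω => BRW.pointMeasure (N [] ω) fun j => X [] j ω) P P

namespace BranchingRandomWalk

variable {d : ℕ} {Ω : Type*} [MeasurableSpace Ω] {P : Measure Ω}

/-- The point process `𝒵(u)` of the displacements of the children of `u`. -/
def offspring (B : BranchingRandomWalk d P) (u : List ℕ) (ω : Ω) : Measure (BRW.RSpace d) :=
  BRW.pointMeasure (B.N u ω) fun j => B.X u j ω

/-- The intensity measure `μ(A) = E[𝒵(A)]` of the reproduction point process. -/
def intensity (B : BranchingRandomWalk d P) : Measure (BRW.RSpace d) :=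
  P.bind (B.offspring [])

theorem intensity_apply (B : BranchingRandomWalk d P) {A : Set (BRW.RSpace d)}
    (hA : MeasurableSet A) : B.intensity A = ∫⁻ ω, B.offspring [] ω A ∂P :=
  Measure.bind_apply hA (B.identDistrib []).aemeasurable_fst

/-- The random set `𝒢_n` of individuals of generation `n`. -/
def generation (B : BranchingRandomWalk d P) : ℕ → Ω → Set (List ℕ)
  | 0, _ => {[]}
  | n + 1, ω => {v | ∃ u ∈ B.generation n ω, ∃ j : ℕ, (j : ℕ∞) < B.N u ω ∧ v = j :: u}

/-- The position `S(u)`. -/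
def position (B : BranchingRandomWalk d P) : List ℕ → Ω → BRW.RSpace d
  | [], _ => 0
  | j :: u, ω => B.position u ω + B.X u j ω

/-- The set `𝒟` of parameters at which the Laplace transform of `μ` converges (absolutely). -/
def domain (B : BranchingRandomWalk d P) : Set (BRW.CSpace d) :=
  {lam | Integrable (fun x => Complex.exp (-BRW.pairing lam x)) B.intensity}

/-- The Laplace transform `m(lam) = ∫ e^{-lam x} μ(dx)`, for `lam ∈ 𝒟`. -/
def laplace (B : BranchingRandomWalk d P) (lam : BRW.CSpace d) : ℂ :=
  ∫ x, Complex.exp (-BRW.pairing lam x) ∂B.intensity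

/-- `L(u) = m(lam)^{-|u|} e^{-lam S(u)}`; only used for individuals `u` that are present. -/
def weight (B : BranchingRandomWalk d P) (lam : BRW.CSpace d) (u : List ℕ) (ω : Ω) : ℂ :=
  (B.laplace lam ^ u.length)⁻¹ * Complex.exp (-BRW.pairing lam (B.position u ω))

/-- The additive martingale `Z_n(lam) = m(lam)^{-n} ∑_{|u| = n} e^{-lam S(u)}`. -/
def additive (B : BranchingRandomWalk d P) (lam : BRW.CSpace d) (n : ℕ) (ω : Ω) : ℂ :=
  (B.laplace lam ^ n)⁻¹ *
    ∑' u : B.generation n ω, Complex.exp (-BRW.pairing lam (B.position u ω))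

/-- `E[∑_{|u| = 1} |L(u)|^α] = 1` and `E[∑_{|u| = 1} |L(u)|^α log |L(u)|] ≤ 0`.
The second expectation takes values in `[-∞, ∞]`; that it exists and is at most `0` means that its
positive part is finite and is at most its negative part. -/
def CharacteristicIndex (B : BranchingRandomWalk d P) (lam : BRW.CSpace d) (α : ℝ) : Prop :=
  (∫⁻ ω, ∑' u : B.generation 1 ω, ENNReal.ofReal (‖B.weight lam u ω‖ ^ α) ∂P) = 1 ∧
  (∫⁻ ω, ∑' u : B.generation 1 ω,
      ENNReal.ofReal (‖B.weight lam u ω‖ ^ α * max (Real.log ‖B.weight lam u ω‖) 0) ∂P) < ∞ ∧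
  (∫⁻ ω, ∑' u : B.generation 1 ω,
      ENNReal.ofReal (‖B.weight lam u ω‖ ^ α * max (Real.log ‖B.weight lam u ω‖) 0) ∂P) ≤
    ∫⁻ ω, ∑' u : B.generation 1 ω,
      ENNReal.ofReal (‖B.weight lam u ω‖ ^ α * max (-Real.log ‖B.weight lam u ω‖) 0) ∂P

/-- `E[|Z_1|^α log_+^{2+ε} |Z_1|] < ∞` for some `ε > 0`. -/
def LogMoment (B : BranchingRandomWalk d P) (lam : BRW.CSpace d) (α : ℝ) : Prop :=
  ∃ ε : ℝ, 0 < ε ∧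
    (∫⁻ ω, ENNReal.ofReal (‖B.additive lam 1 ω‖ ^ α *
      (max (Real.log ‖B.additive lam 1 ω‖) 0) ^ (2 + ε)) ∂P) < ∞

end BranchingRandomWalk

end

/-! Write the walk as a cascade of complex edge weights, zero for absent children, so that `Z_n` is
the sum over all words of length `n` of products of weights, and `Z_n - 1` is the sum over words `u`
shorter than `n` of the increments `L(u) (Z_1^{(u)} - 1)`, with `Z_1^{(u)}` the total weight below
`u`. Everything rests on the tail bound `P(|Z_n - 1| > 2t) ≤ C t^{-α} (1 + log t)`, uniform in `n`
(`measure_genSum_sub_one_le`).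

To obtain it, kill every line of descent when its weight first exceeds `t`. The sum of `|L(u)|^α`
has constant mean 1, so with probability at least `1 - t^{-α}` nothing is killed
(`measure_exceed_le`). For the surviving words, cut each increment at size `t` and center it. The
centered small parts are orthogonal and bounded in `L²`; the remainders are bounded in `L¹`. In both
cases the moment hypothesis on `Z_1` bounds the contribution of `u` by a power of `t` times
`|L(u)|^α (1 + log t - log |L(u)|)^{-2}` (`enorm_trunc_sq_le`, `enorm_sub_trunc_le`).

The expected sum of these quantities is computed by a change of measure with density `|w|^α`
(`lintegral_gen_trunc`): it is the Green function of a real random walk with steps `-log |w|`,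
killed below `-log t` and tested on an inverse square. This Green function grows at most linearly in
`log t` (`tsum_iterate_killedOp_le`). To see this, split a path at its first minimum: descending
records above `-n` are at most linearly many in expectation, and the part after the minimum,
reversed in time, ends at an ascending record, of which a unit interval carries boundedly many. The
argument needs the walk to make positive steps; that follows from the logarithmic condition and
supercriticality (`stepLaw_Ioi_ne_zero`).

The tail bound gives bounded moments of every order below `α`, in particular of some order above 1.
Martingale convergence then yields an almost sure limit, uniform integrability yields convergence in
`L^p`, and a constant limit would force `Z_1 = 1` almost surely. -/

namespace BRW

/-! ### Functions of disjoint subfamilies of an independent family. -/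

section Independence

variable {ι Ω β : Type*} [mβ : MeasurableSpace β] {X : ι → Ω → β}

/-- The σ-algebra generated by the random variables `X i` with `i ∈ S`. -/
abbrev sigmaOf (X : ι → Ω → β) (S : Set ι) : MeasurableSpace Ω :=
  ⨆ i ∈ S, MeasurableSpace.comap (X i) mβ

lemma sigmaOf_le [mΩ : MeasurableSpace Ω] (hX : ∀ i, Measurable (X i)) (S : Set ι) : sigmaOf X S ≤ mΩ :=
  iSup₂_le fun i _ => (hX i).comap_le

lemma sigmaOf_mono {S T : Set ι} (h : S ⊆ T) : sigmaOf X S ≤ sigmaOf X T :=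
  biSup_mono h

lemma measurable_sigmaOf {S : Set ι} {i : ι} (h : i ∈ S) : Measurable[sigmaOf X S] (X i) :=
  measurable_iff_comap_le.2 (le_iSup₂ (f := fun i (_ : i ∈ S) => MeasurableSpace.comap (X i) mβ) i h)

lemma indepFun_of_sigmaOf [mΩ : MeasurableSpace Ω] {P : Measure Ω} (hX : ∀ i, Measurable (X i)) (h : iIndepFun X P) {S T : Set ι}
    (hST : Disjoint S T) {γ δ : Type*} [MeasurableSpace γ] [MeasurableSpace δ] {f : Ω → γ}
    {g : Ω → δ} (hf : Measurable[sigmaOf X S] f) (hg : Measurable[sigmaOf X T] g) :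
    IndepFun f g P := by
  rw [IndepFun_iff_Indep]
  exact indep_of_indep_of_le_left (indep_of_indep_of_le_right
    (indep_iSup_of_disjoint (fun i => (hX i).comap_le) h hST) hg.comap_le) hf.comap_le

lemma lintegral_indepFun [mΩ : MeasurableSpace Ω] {P : Measure Ω} [IsFiniteMeasure P]
    {γ δ : Type*} [MeasurableSpace γ] [MeasurableSpace δ] {U : Ω → γ} {V : Ω → δ}
    (hU : Measurable U) (hV : Measurable V) (h : IndepFun U V P) {G : γ × δ → ℝ≥0∞}
    (hG : Measurable G) :
    ∫⁻ ω, G (U ω, V ω) ∂P = ∫⁻ ω, ∫⁻ ω', G (U ω, V ω') ∂P ∂P := by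
  rw [← lintegral_map (f := G) hG (hU.prodMk hV),
    (indepFun_iff_map_prod_eq_prod_map_map hU.aemeasurable hV.aemeasurable).1 h,
    lintegral_prod _ hG.aemeasurable, lintegral_map hG.lintegral_prod_right' hU]
  refine lintegral_congr fun ω => ?_
  exact lintegral_map (hG.comp measurable_prodMk_left) hV

end Independence

/-! ### Records of a one-dimensional random walk. -/

namespace RandomWalk

/-- Partial sums of a sequence. -/
def psum (x : ℕ → ℝ) (k : ℕ) : ℝ := ∑ i ∈ Finset.range k, x i

@[simp] lemma psum_zero (x : ℕ → ℝ) : psum x 0 = 0 := by simp [psum]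

lemma psum_succ (x : ℕ → ℝ) (k : ℕ) : psum x (k + 1) = psum x k + x k := Finset.sum_range_succ _ _

lemma psum_neg (x : ℕ → ℝ) (k : ℕ) : psum (-x) k = -psum x k := by simp [psum]

lemma psum_congr {x y : ℕ → ℝ} {k : ℕ} (h : ∀ i < k, x i = y i) : psum x k = psum y k :=
  Finset.sum_congr rfl fun i hi => h i (Finset.mem_range.1 hi)

@[fun_prop]
lemma measurable_psum (k : ℕ) : Measurable fun x : ℕ → ℝ => psum x k := by
  unfold psum; fun_prop

/-- The time `i` is a weak ascending record. -/
def IsRecord (x : ℕ → ℝ) (i : ℕ) : Prop := ∀ j ≤ i, psum x j ≤ psum x i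

lemma measurableSet_isRecord (i : ℕ) : MeasurableSet {x : ℕ → ℝ | IsRecord x i} := by
  have : {x : ℕ → ℝ | IsRecord x i} = ⋂ j, ⋂ (_ : j ≤ i), {x | psum x j ≤ psum x i} := by
    ext; simp [IsRecord]
  rw [this]
  exact MeasurableSet.iInter fun j => MeasurableSet.iInter fun _ =>
    measurableSet_le (measurable_psum j) (measurable_psum i)

/-- The law of an i.i.d. sequence with marginal `ν`. -/
noncomputable abbrev seqLaw (ν : Measure ℝ) : Measure (ℕ → ℝ) := Measure.infinitePi fun _ : ℕ => ν

variable {ν : Measure ℝ} [IsProbabilityMeasure ν]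

lemma iIndepFun_coord : iIndepFun (fun (i : ℕ) (x : ℕ → ℝ) => x i) (seqLaw ν) :=
  iIndepFun_infinitePi (X := fun _ (y : ℝ) => y) (fun _ => measurable_id)

lemma map_coord (i : ℕ) : (seqLaw ν).map (fun x => x i) = ν :=
  Measure.infinitePi_map_eval (fun _ : ℕ => ν) i

/-- Used for time reversal: any injective selection of i.i.d. steps is again i.i.d. with the same
law. -/
lemma map_precomp {σ : ℕ → ℕ} (hσ : σ.Injective) :
    (seqLaw ν).map (fun x i => x (σ i)) = seqLaw ν := by
  have h := (iIndepFun_coord (ν := ν)).precomp hσ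
  rw [h.map_fun_eq_infinitePi_map (fun i => measurable_pi_apply _)]
  simp_rw [map_coord]

lemma map_neg_seqLaw : (seqLaw ν).map (fun x => -x) = seqLaw (ν.map Neg.neg) :=
  Measure.infinitePi_map_pi (fun _ : ℕ => ν) (f := fun _ => Neg.neg) (fun _ => measurable_neg)

lemma measurable_psum_sigmaOf {k : ℕ} {S : Set ℕ} (h : ∀ i < k, i ∈ S) :
    Measurable[sigmaOf (fun (i : ℕ) (x : ℕ → ℝ) => x i) S] fun x => psum x k := by
  unfold psum
  exact Finset.measurable_sum _ fun i hi =>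
    measurable_sigmaOf (X := fun (i : ℕ) (x : ℕ → ℝ) => x i) (h i (Finset.mem_range.1 hi))

/-- If a record in `[b, b + δ)` is followed by a step larger than `δ`, the walk is then above `b +
δ`, so no later record can fall in the interval. These events are therefore disjoint over `i`, and
the step at time `i` is independent of the walk up to time `i`. -/
lemma tsum_record_short (δ b : ℝ) :
    (∑' i, seqLaw ν {x | IsRecord x i ∧ psum x i ∈ Set.Ico b (b + δ)}) * ν (Set.Ioi δ) ≤ 1 := by
  set B : ℕ → Set (ℕ → ℝ) := fun i => {x | IsRecord x i ∧ psum x i ∈ Set.Ico b (b + δ)} with hB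
  set C : ℕ → Set (ℕ → ℝ) := fun i => B i ∩ {x | δ < x i} with hC
  have hBm : ∀ i, MeasurableSet (B i) := fun i =>
    (measurableSet_isRecord i).inter (measurable_psum i measurableSet_Ico)
  have hCm : ∀ i, MeasurableSet (C i) := fun i =>
    (hBm i).inter (measurableSet_lt measurable_const (measurable_pi_apply i))
  have hmul : ∀ i, seqLaw ν (B i) * ν (Set.Ioi δ) = seqLaw ν (C i) := by
    intro i
    -- The partial sums up to time `i` involve only the steps with index below `i`.
    have hind : IndepFun (fun x : ℕ → ℝ => fun j : Fin (i + 1) => psum x j) (fun x : ℕ → ℝ => x i)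
        (seqLaw ν) := by
      refine indepFun_of_sigmaOf (fun i => measurable_pi_apply i) iIndepFun_coord
        (S := Set.Iio i) (T := {i}) (by simp) ?_ (measurable_sigmaOf (X := fun (i : ℕ) (x : ℕ → ℝ) => x i) rfl)
      exact @measurable_pi_lambda _ _ _ (sigmaOf _ _) _ _ fun j =>
        measurable_psum_sigmaOf fun k hk => by
          have := j.2; simp only [Set.mem_Iio]; omega
    have hA : MeasurableSet ((⋂ j, {y : Fin (i + 1) → ℝ | y j ≤ y (Fin.last i)}) ∩
        (fun y => y (Fin.last i)) ⁻¹' Set.Ico b (b + δ)) :=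
      (MeasurableSet.iInter fun j => measurableSet_le (measurable_pi_apply j)
        (measurable_pi_apply (Fin.last i))).inter ((measurable_pi_apply (Fin.last i)) measurableSet_Ico)
    have := hind.measure_inter_preimage_eq_mul _ _ hA (measurableSet_Ioi (a := δ))
    rw [← map_coord (ν := ν) i, Measure.map_apply (measurable_pi_apply i) measurableSet_Ioi]
    rw [map_coord]
    convert this.symm using 2
    · congr 1
      ext x
      simp only [hB, Set.mem_ofPred_eq, Set.mem_preimage, IsRecord, Fin.val_last, Set.mem_inter_iff,
        Set.mem_iInter]
      refine and_congr_left fun _ => ⟨fun h j => h j (Nat.lt_succ_iff.1 j.2), fun h j hj =>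
        h ⟨j, Nat.lt_succ_iff.2 hj⟩⟩
    · ext x
      simp only [hC, hB, Set.mem_inter_iff, Set.mem_ofPred_eq, Set.mem_preimage, IsRecord, Fin.val_last,
        Set.mem_Ioi, Set.mem_iInter]
      refine and_congr_left fun _ => and_congr_left fun _ =>
        ⟨fun h j => h j (Nat.lt_succ_iff.1 j.2), fun h j hj => h ⟨j, Nat.lt_succ_iff.2 hj⟩⟩
  change (∑' i, seqLaw ν (B i)) * _ ≤ 1
  rw [← ENNReal.tsum_mul_right]
  simp_rw [hmul]
  have hdisj : Pairwise (Function.onFun Disjoint C) := by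
    have key : ∀ i j, i < j → Disjoint (C i) (C j) := by
      intro i j hij
      rw [Set.disjoint_left]
      rintro x ⟨⟨-, h1⟩, h2⟩ ⟨⟨h3, h4⟩, -⟩
      have h5 := h3 (i + 1) hij
      rw [psum_succ] at h5
      have h6 := h1.1
      have h7 := h4.2
      simp only [Set.mem_ofPred_eq] at h2
      linarith
    intro i j hij
    rcases lt_or_gt_of_ne hij with h | h
    · exact key i j h
    · exact (key j i h).symm
  rw [← measure_iUnion hdisj hCm]
  exact prob_le_one

lemma exists_ofNat_pos {ν : Measure ℝ} (h : ν (Set.Ioi 0) ≠ 0) :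
    ∃ M : ℕ, ν (Set.Ioi (1 / ((M : ℝ) + 1))) ≠ 0 := by
  by_contra! hM
  apply h
  have : Set.Ioi (0 : ℝ) = ⋃ M : ℕ, Set.Ioi (1 / ((M : ℝ) + 1)) := by
    ext y
    simp only [Set.mem_Ioi, Set.mem_iUnion]
    exact ⟨fun hy => exists_nat_one_div_lt hy, fun ⟨M, hM⟩ => lt_trans (by positivity) hM⟩
  rw [this]
  exact measure_iUnion_null hM

/-- The expected number of weak ascending records in an interval of integer length `n` is at most
linear in `n`, if the steps can be positive. -/
lemma tsum_record_le (h : ν (Set.Ioi 0) ≠ 0) :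
    ∃ C : ℝ≥0∞, C ≠ ∞ ∧ ∀ (n : ℕ) (b : ℝ),
      ∑' i, seqLaw ν {x | IsRecord x i ∧ psum x i ∈ Set.Ico b (b + n)} ≤ C * n := by
  obtain ⟨M, hM⟩ := exists_ofNat_pos h
  -- The reciprocal of an integer, so that an interval of length `n` splits into exactly `n * (M +
  -- 1)` cells of length `δ`.
  set δ : ℝ := 1 / ((M : ℝ) + 1) with hδ
  have hδ0 : 0 < δ := by positivity
  refine ⟨(M + 1) * (ν (Set.Ioi δ))⁻¹, ENNReal.mul_ne_top (by finiteness) (by simpa using hM), ?_⟩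
  intro n b
  have hcov : ∀ y ∈ Set.Ico b (b + n), ∃ k ∈ Finset.range (n * (M + 1)),
      y ∈ Set.Ico (b + k * δ) (b + k * δ + δ) := by
    intro y hy
    have h0 : 0 ≤ (y - b) / δ := div_nonneg (by linarith [hy.1]) hδ0.le
    refine ⟨⌊(y - b) / δ⌋₊, ?_, ?_, ?_⟩
    · rw [Finset.mem_range, Nat.floor_lt h0, div_lt_iff₀ hδ0, hδ]
      push_cast
      have : (n : ℝ) * (M + 1) * (1 / (M + 1)) = n := by field_simp
      rw [this]
      linarith [hy.2]
    · have := Nat.floor_le h0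
      rw [le_div_iff₀ hδ0] at this
      linarith
    · have := Nat.lt_floor_add_one ((y - b) / δ)
      rw [div_lt_iff₀ hδ0] at this
      linarith
  have h1 : ∀ i, seqLaw ν {x | IsRecord x i ∧ psum x i ∈ Set.Ico b (b + n)} ≤
      ∑ k ∈ Finset.range (n * (M + 1)), seqLaw ν {x | IsRecord x i ∧
        psum x i ∈ Set.Ico (b + k * δ) (b + k * δ + δ)} := by
    intro i
    refine (measure_mono ?_).trans (measure_biUnion_finset_le _ _)
    rintro x ⟨hx1, hx2⟩
    obtain ⟨k, hk, hk'⟩ := hcov _ hx2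
    exact Set.mem_biUnion (Finset.mem_coe.2 hk) ⟨hx1, hk'⟩
  refine (ENNReal.tsum_le_tsum h1).trans ?_
  rw [Summable.tsum_finsetSum (fun _ _ => ENNReal.summable)]
  have h2 : ∀ k ∈ Finset.range (n * (M + 1)), ∑' i, seqLaw ν {x | IsRecord x i ∧
        psum x i ∈ Set.Ico (b + k * δ) (b + k * δ + δ)} ≤ (ν (Set.Ioi δ))⁻¹ := by
    intro k _
    have := tsum_record_short (ν := ν) δ (b + k * δ)
    rwa [ENNReal.le_inv_iff_mul_le]
  refine (Finset.sum_le_sum h2).trans ?_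
  rw [Finset.sum_const, Finset.card_range, nsmul_eq_mul]
  push_cast
  exact le_of_eq (by ring)

end RandomWalk
end BRW

/-! ### Visits to a unit interval before falling below a level. -/

namespace BRW
namespace RandomWalk

variable {ν : Measure ℝ} [IsProbabilityMeasure ν]

/-- The time `i` is a strict descending record with value at least `-n`. -/
def descRecordSet (n : ℕ) (i : ℕ) : Set (ℕ → ℝ) :=
  {x | (∀ j < i, psum x i < psum x j) ∧ -(n : ℝ) ≤ psum x i}

lemma measurableSet_descRecordSet (n i : ℕ) : MeasurableSet (descRecordSet n i) := by
  have : descRecordSet n i = (⋂ j, ⋂ (_ : j < i), {x | psum x i < psum x j}) ∩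
      {x | -(n : ℝ) ≤ psum x i} := by
    ext; simp [descRecordSet]
  rw [this]
  exact (MeasurableSet.iInter fun j => MeasurableSet.iInter fun _ =>
    measurableSet_lt (measurable_psum i) (measurable_psum j)).inter
      (measurableSet_le measurable_const (measurable_psum i))

/-- Reflection turns these records into ascending records of the negated walk in `[0, n + 1)`; the
length is `n + 1` because the interval is half-open and must contain `n`. If there are no negative
steps, only time `0` counts. -/
lemma tsum_descRecord_le (ν : Measure ℝ) [IsProbabilityMeasure ν] :
    ∃ C : ℝ≥0∞, C ≠ ∞ ∧ ∀ n : ℕ, ∑' i, seqLaw ν (descRecordSet n i) ≤ C * (n + 1) := by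
  by_cases h : ν (Set.Iio 0) = 0
  · refine ⟨1, by simp, fun n => ?_⟩
    rw [tsum_eq_single 0]
    · exact prob_le_one.trans (by simp)
    · intro i hi
      obtain ⟨i, rfl⟩ := Nat.exists_eq_succ_of_ne_zero hi
      refine measure_mono_null (t := (fun x : ℕ → ℝ => x i) ⁻¹' Set.Iio 0) ?_ ?_
      · intro x hx
        have := hx.1 i (Nat.lt_succ_self i)
        rw [psum_succ] at this
        simp only [Set.mem_preimage, Set.mem_Iio]
        linarith
      · rw [← Measure.map_apply (measurable_pi_apply i) measurableSet_Iio, map_coord, h]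
  · have : IsProbabilityMeasure (ν.map Neg.neg) :=
      Measure.isProbabilityMeasure_map measurable_neg.aemeasurable
    obtain ⟨C, hC, hC'⟩ := tsum_record_le (ν := ν.map Neg.neg) (by
      rw [Measure.map_apply measurable_neg measurableSet_Ioi]
      convert h using 3
      ext; simp)
    refine ⟨C, hC, fun n => ?_⟩
    refine le_trans ?_ (by simpa using hC' (n + 1) 0)
    refine ENNReal.tsum_le_tsum fun i => ?_
    rw [← map_neg_seqLaw, Measure.map_apply measurable_neg]
    · refine measure_mono ?_
      rintro x ⟨h1, h2⟩
      have h3 : ∀ j ≤ i, psum x i ≤ psum x j := fun j hj => by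
        rcases hj.lt_or_eq with hj | rfl
        · exact (h1 j hj).le
        · exact le_rfl
      refine ⟨fun j hj => ?_, ?_, ?_⟩
      · simpa [psum_neg] using h3 j hj
      · simpa [psum_neg] using h3 0 (Nat.zero_le _)
      · rw [psum_neg]
        linarith
    · exact (measurableSet_isRecord i).inter ((measurableSet_le measurable_const
        (measurable_psum i)).inter (measurableSet_lt (measurable_psum i) measurable_const))

/-- Choosing the first minimizer makes it a strict descending record, the time at which paths are
split below. -/
lemma exists_first_min (f : ℕ → ℝ) (k : ℕ) :
    ∃ l ≤ k, (∀ j < l, f l < f j) ∧ ∀ j ≤ k, f l ≤ f j := by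
  classical
  have hex : ∃ l, l ≤ k ∧ ∀ j ≤ k, f l ≤ f j := by
    obtain ⟨l, hl, hl'⟩ := Finset.exists_min_image (Finset.range (k + 1)) f ⟨0, by simp⟩
    exact ⟨l, by simpa [Nat.lt_succ_iff] using hl, fun j hj => hl' j (by simpa [Nat.lt_succ_iff] using hj)⟩
  refine ⟨Nat.find hex, (Nat.find_spec hex).1, fun j hj => ?_, (Nat.find_spec hex).2⟩
  by_contra! hlt
  refine Nat.find_min hex hj ⟨hj.le.trans (Nat.find_spec hex).1, fun i hi => ?_⟩
  exact hlt.trans ((Nat.find_spec hex).2 i hi)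

/-- The times in the window `[l, l + i)` in reverse order, followed by the times after it. -/
def reverseWindow (l i j : ℕ) : ℕ := if j < i then l + (i - 1 - j) else l + j

/-- The indices beyond the window serve only to make the map injective on all of `ℕ`, so that
`map_precomp` applies. -/
lemma reverseWindow_injective (l i : ℕ) : (reverseWindow l i).Injective := by
  intro a b h
  unfold reverseWindow at h
  split_ifs at h <;> omega

lemma le_reverseWindow (l i j : ℕ) : l ≤ reverseWindow l i j := by
  unfold reverseWindow
  split_ifs <;> omega

lemma psum_reverseWindow (x : ℕ → ℝ) (l i : ℕ) {j : ℕ} (hj : j ≤ i) :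
    psum (fun a => x (reverseWindow l i a)) j = psum x (l + i) - psum x (l + i - j) := by
  induction j with
  | zero => simp
  | succ j ih =>
    have h1 : l + i - j = (l + i - (j + 1)) + 1 := by omega
    have h2 : reverseWindow l i j = l + i - (j + 1) := by
      unfold reverseWindow
      rw [if_pos (by omega)]
      omega
    rw [psum_succ, ih (by omega), h1, psum_succ, h2]
    ring

/-- The walk has stayed above its value at the descending record `l` for `i` further steps, and is
then in `I`. -/
def excursionSet (n l i : ℕ) (c : ℝ) : Set (ℕ → ℝ) :=
  {x | x ∈ descRecordSet n l ∧ (∀ j ≤ i, psum x l ≤ psum x (l + j)) ∧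
    psum x (l + i) ∈ Set.Ico c (c + 1)}

/-- The steps before `l` are independent of those from `l` on. Reversing the latter turns "stays
above the value at `l`" into "the endpoint is a weak ascending record", and the target interval is
shifted by the value at `l`. -/
lemma measure_excursionSet_le (n l i : ℕ) (c : ℝ) :
    seqLaw ν (excursionSet n l i c) ≤ ∫⁻ u in descRecordSet n l,
      seqLaw ν {v | IsRecord v i ∧ psum v i ∈ Set.Ico (c - psum u l) (c - psum u l + 1)}
        ∂((seqLaw ν).map fun x j => if j < l then x j else 0) := by
  -- The past, padded by zeros so as to remain in sequence space; partial sums up to `l` do not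
  -- change.
  set U : (ℕ → ℝ) → ℕ → ℝ := fun x j => if j < l then x j else 0 with hU
  set V : (ℕ → ℝ) → ℕ → ℝ := fun x j => x (reverseWindow l i j) with hV
  have hUpsum : ∀ x, ∀ j ≤ l, psum (U x) j = psum x j := fun x j hj =>
    psum_congr fun a ha => by simp [hU, ha.trans_le hj]
  have hUm : Measurable[sigmaOf (fun (i : ℕ) (x : ℕ → ℝ) => x i) (Set.Iio l)] U := by
    refine @measurable_pi_lambda _ _ _ (sigmaOf _ _) _ _ fun j => ?_
    by_cases hj : j < l
    · simp only [hU, hj, if_true]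
      exact measurable_sigmaOf (X := fun (i : ℕ) (x : ℕ → ℝ) => x i) hj
    · simp only [hU, hj, if_false]
      exact @measurable_const _ _ _ (sigmaOf _ _) _
  have hVm : Measurable[sigmaOf (fun (i : ℕ) (x : ℕ → ℝ) => x i) (Set.Ici l)] V :=
    @measurable_pi_lambda _ _ _ (sigmaOf _ _) _ _ fun j =>
      measurable_sigmaOf (X := fun (i : ℕ) (x : ℕ → ℝ) => x i) (le_reverseWindow l i j)
  have hle := fun S => sigmaOf_le (X := fun (i : ℕ) (x : ℕ → ℝ) => x i)
    (fun i => measurable_pi_apply i) S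
  have hind : IndepFun U V (seqLaw ν) := indepFun_of_sigmaOf (fun i => measurable_pi_apply i)
    iIndepFun_coord (Set.Iio_disjoint_Ici le_rfl) hUm hVm
  have hUm' : Measurable U := hUm.mono (hle _) le_rfl
  have hVm' : Measurable V := hVm.mono (hle _) le_rfl
  have hprod := (indepFun_iff_map_prod_eq_prod_map_map hUm'.aemeasurable hVm'.aemeasurable).1 hind
  rw [map_precomp (reverseWindow_injective l i)] at hprod
  set F : Set ((ℕ → ℝ) × (ℕ → ℝ)) := {p | p.1 ∈ descRecordSet n l ∧ IsRecord p.2 i ∧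
    psum p.2 i ∈ Set.Ico (c - psum p.1 l) (c - psum p.1 l + 1)} with hF
  have hm1 : Measurable fun p : (ℕ → ℝ) × (ℕ → ℝ) => psum p.1 l :=
    (measurable_psum l).comp measurable_fst
  have hm2 : Measurable fun p : (ℕ → ℝ) × (ℕ → ℝ) => psum p.2 i :=
    (measurable_psum i).comp measurable_snd
  have hFm : MeasurableSet F :=
    (measurable_fst (measurableSet_descRecordSet n l)).inter
      ((measurable_snd (measurableSet_isRecord i)).inter
        ((measurableSet_le (hm1.const_sub c) hm2).inter
          (measurableSet_lt hm2 ((hm1.const_sub c).add_const 1))))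
  have hsub : excursionSet n l i c ⊆ (fun x => (U x, V x)) ⁻¹' F := by
    rintro x ⟨⟨h1, h2⟩, h3, h4⟩
    refine ⟨⟨fun j hj => ?_, ?_⟩, fun j hj => ?_, ?_⟩
    · rw [hUpsum x l le_rfl, hUpsum x j hj.le]
      exact h1 j hj
    · rwa [hUpsum x l le_rfl]
    · rw [psum_reverseWindow x l i hj, psum_reverseWindow x l i le_rfl, Nat.add_sub_cancel]
      have := h3 (i - j) (Nat.sub_le _ _)
      rw [← Nat.add_sub_assoc hj] at this
      linarith
    · rw [psum_reverseWindow x l i le_rfl, Nat.add_sub_cancel, hUpsum x l le_rfl]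
      exact ⟨by linarith [h4.1], by linarith [h4.2]⟩
  refine (measure_mono hsub).trans ?_
  rw [← Measure.map_apply (hUm'.prodMk hVm') hFm, hprod, Measure.prod_apply hFm,
    ← lintegral_indicator (measurableSet_descRecordSet n l)]
  refine lintegral_mono fun u => ?_
  by_cases hu : u ∈ descRecordSet n l
  · rw [Set.indicator_of_mem hu]
    exact measure_mono fun v hv => hv.2
  · rw [Set.indicator_of_notMem hu]
    have : Prod.mk u ⁻¹' F = ∅ := by
      ext v
      simp [hF, hu]
    simp [this]

/-- The expected number of visits to an interval of unit length, before the walk goes below `-n`, is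
at most linear in `n`. -/
lemma tsum_killed_visit_le (h : ν (Set.Ioi 0) ≠ 0) :
    ∃ C : ℝ≥0∞, C ≠ ∞ ∧ ∀ (n : ℕ) (c : ℝ),
      ∑' k, seqLaw ν {x | (∀ j ≤ k, -(n : ℝ) ≤ psum x j) ∧ psum x k ∈ Set.Ico c (c + 1)} ≤
        C * (n + 1) := by
  obtain ⟨C₁, hC₁, h₁⟩ := tsum_record_le h
  obtain ⟨C₂, hC₂, h₂⟩ := tsum_descRecord_le ν
  refine ⟨C₁ * C₂, ENNReal.mul_ne_top hC₁ hC₂, fun n c => ?_⟩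
  have hstep : ∀ k, seqLaw ν {x | (∀ j ≤ k, -(n : ℝ) ≤ psum x j) ∧ psum x k ∈ Set.Ico c (c + 1)} ≤
      ∑ p ∈ Finset.HasAntidiagonal.antidiagonal k, seqLaw ν (excursionSet n p.1 p.2 c) := by
    intro k
    refine (measure_mono ?_).trans (measure_biUnion_finset_le _ _)
    rintro x ⟨hx1, hx2⟩
    -- The split point: before it a descending record above `-n`, after it an excursion of `k - l`
    -- steps.
    obtain ⟨l, hl, h3, h4⟩ := exists_first_min (psum x) k
    refine Set.mem_biUnion (x := (l, k - l)) (by simp [hl]) ⟨⟨h3, hx1 l hl⟩, fun j hj => ?_, ?_⟩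
    · exact h4 _ (by simp only at hj; omega)
    · simpa [Nat.add_sub_cancel' hl] using hx2
  have hsum : ∀ l, ∑' i, seqLaw ν (excursionSet n l i c) ≤ C₁ * seqLaw ν (descRecordSet n l) := by
    intro l
    have hUm : Measurable fun (x : ℕ → ℝ) (j : ℕ) => if j < l then x j else 0 := by
      refine measurable_pi_lambda _ fun j => ?_
      by_cases hj : j < l
      · simp only [hj, if_true]; exact measurable_pi_apply j
      · simp only [hj, if_false]; exact measurable_const
    have hmeas : ∀ i, Measurable fun u : ℕ → ℝ => seqLaw ν {v | IsRecord v i ∧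
        psum v i ∈ Set.Ico (c - psum u l) (c - psum u l + 1)} := by
      intro i
      have hm1 : Measurable fun p : (ℕ → ℝ) × (ℕ → ℝ) => psum p.1 l :=
        (measurable_psum l).comp measurable_fst
      have hm2 : Measurable fun p : (ℕ → ℝ) × (ℕ → ℝ) => psum p.2 i :=
        (measurable_psum i).comp measurable_snd
      exact measurable_measure_prodMk_left (ν := seqLaw ν)
        (s := {p : (ℕ → ℝ) × (ℕ → ℝ) | IsRecord p.2 i ∧
          psum p.2 i ∈ Set.Ico (c - psum p.1 l) (c - psum p.1 l + 1)})
        ((measurable_snd (measurableSet_isRecord i)).inter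
        ((measurableSet_le (hm1.const_sub c) hm2).inter
          (measurableSet_lt hm2 ((hm1.const_sub c).add_const 1))))
    refine (ENNReal.tsum_le_tsum fun i => measure_excursionSet_le n l i c).trans ?_
    rw [← lintegral_tsum fun i => (hmeas i).aemeasurable]
    refine (lintegral_mono (g := fun _ => C₁) fun u => ?_).trans ?_
    -- The bound for ascending records is uniform in the position of the interval, hence in the past
    -- `u`.
    · simpa using h₁ 1 (c - psum u l)
    · rw [setLIntegral_const, Measure.map_apply hUm (measurableSet_descRecordSet n l)]
      gcongr
      rintro x ⟨h3, h4⟩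
      have hp : ∀ j ≤ l, psum (fun j => if j < l then x j else 0) j = psum x j := fun j hj =>
        psum_congr fun a ha => by simp [ha.trans_le hj]
      rw [hp l le_rfl] at h4
      refine ⟨fun j hj => ?_, h4⟩
      have := h3 j hj
      rwa [hp l le_rfl, hp j hj.le] at this
  calc _ ≤ ∑' k, ∑ p ∈ Finset.HasAntidiagonal.antidiagonal k, seqLaw ν (excursionSet n p.1 p.2 c) :=
        ENNReal.tsum_le_tsum hstep
    _ = ∑' l, ∑' i, seqLaw ν (excursionSet n l i c) := by
        rw [← ENNReal.tsum_prod (f := fun l i => seqLaw ν (excursionSet n l i c)),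
          ← (Finset.HasAntidiagonal.sigmaAntidiagonalEquivProd (A := ℕ)).tsum_eq, ENNReal.tsum_sigma']
        refine tsum_congr fun k => ?_
        rw [← Finset.tsum_subtype]
        rfl
    _ ≤ ∑' l, C₁ * seqLaw ν (descRecordSet n l) := ENNReal.tsum_le_tsum hsum
    _ ≤ C₁ * C₂ * (n + 1) := by
        rw [ENNReal.tsum_mul_left, mul_assoc]
        gcongr
        exact h₂ n

end RandomWalk
end BRW

/-! ### The Green function of the killed walk. -/

namespace BRW
namespace RandomWalk

variable {ν : Measure ℝ} [IsProbabilityMeasure ν]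

/-- The transition operator of the random walk with steps `ν` killed below `-x`. -/
noncomputable def killedOp (ν : Measure ℝ) (x : ℝ) (φ : ℝ → ℝ≥0∞) (y : ℝ) : ℝ≥0∞ :=
  ∫⁻ z, (if -x ≤ y + z then φ (y + z) else 0) ∂ν

lemma measurable_killedOp {ν : Measure ℝ} [SFinite ν] (x : ℝ) {φ : ℝ → ℝ≥0∞} (hφ : Measurable φ) :
    Measurable (killedOp ν x φ) := by
  have : Measurable fun p : ℝ × ℝ => if -x ≤ p.1 + p.2 then φ (p.1 + p.2) else 0 :=
    Measurable.ite (measurableSet_le measurable_const (by fun_prop)) (by fun_prop)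
      measurable_const
  exact this.lintegral_prod_right'

open Classical in
/-- The indicator of the event that the walk has not gone below `-x` up to time `k`. -/
noncomputable def alive (x : ℝ) (k : ℕ) (s : ℕ → ℝ) : ℝ≥0∞ :=
  if ∀ j ≤ k, -x ≤ psum s j then 1 else 0

lemma alive_succ (x : ℝ) (k : ℕ) (s : ℕ → ℝ) :
    alive x (k + 1) s = alive x k s * if -x ≤ psum s k + s k then 1 else 0 := by
  unfold alive
  have : (∀ j ≤ k + 1, -x ≤ psum s j) ↔ (∀ j ≤ k, -x ≤ psum s j) ∧ -x ≤ psum s k + s k := by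
    rw [← psum_succ]
    constructor
    · exact fun h => ⟨fun j hj => h j (by omega), h _ le_rfl⟩
    · rintro ⟨h1, h2⟩ j hj
      rcases Nat.le_succ_iff.1 hj with h | rfl
      · exact h1 j h
      · exact h2
  simp only [this]
  split_ifs <;> simp_all

lemma measurable_alive_sigmaOf (x : ℝ) (k : ℕ) :
    Measurable[sigmaOf (fun (i : ℕ) (s : ℕ → ℝ) => s i) (Set.Iio k)] (alive x k) := by
  classical
  refine Measurable.ite ?_ measurable_const measurable_const
  have : {s : ℕ → ℝ | ∀ j ≤ k, -x ≤ psum s j} = ⋂ j, ⋂ (_ : j ≤ k), {s | -x ≤ psum s j} := by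
    ext; simp
  rw [this]
  refine MeasurableSet.iInter fun j => MeasurableSet.iInter fun hj => ?_
  exact (measurable_psum_sigmaOf fun i hi => lt_of_lt_of_le hi hj) (measurableSet_Ici (a := -x))

lemma measurable_alive (x : ℝ) (k : ℕ) : Measurable (alive x k) :=
  (measurable_alive_sigmaOf x k).mono (sigmaOf_le (fun i => measurable_pi_apply i) _) le_rfl

/-- The innermost application of the operator is the last step of the walk, which is independent of
the path so far; hence an induction with `φ` varying. The sign of `x` makes the walk alive at time
`0`. -/
lemma iterate_killedOp_eq {x : ℝ} (hx : 0 ≤ x) (k : ℕ) {φ : ℝ → ℝ≥0∞} (hφ : Measurable φ) :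
    (killedOp ν x)^[k] φ 0 = ∫⁻ s, alive x k s * φ (psum s k) ∂(seqLaw ν) := by
  induction k generalizing φ with
  | zero => simp [alive, hx]
  | succ k ih =>
    rw [Function.iterate_succ_apply, ih (measurable_killedOp x hφ)]
    have hind : IndepFun (fun s : ℕ → ℝ => (psum s k, alive x k s)) (fun s : ℕ → ℝ => s k)
        (seqLaw ν) := by
      refine indepFun_of_sigmaOf (fun i => measurable_pi_apply i) iIndepFun_coord
        (S := Set.Iio k) (T := {k}) (by simp) ?_
        (measurable_sigmaOf (X := fun (i : ℕ) (x : ℕ → ℝ) => x i) rfl)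
      exact Measurable.prodMk (measurable_psum_sigmaOf fun i hi => hi) (measurable_alive_sigmaOf x k)
    have hG : Measurable fun p : (ℝ × ℝ≥0∞) × ℝ =>
        p.1.2 * if -x ≤ p.1.1 + p.2 then φ (p.1.1 + p.2) else 0 :=
      Measurable.mul (by fun_prop) (Measurable.ite (measurableSet_le measurable_const
        (by fun_prop)) (by fun_prop) measurable_const)
    have h := lintegral_indepFun ((measurable_psum k).prodMk (measurable_alive x k))
      (measurable_pi_apply k) hind hG
    simp only at h
    trans ∫⁻ s, alive x k s * (if -x ≤ psum s k + s k then φ (psum s k + s k) else 0) ∂(seqLaw ν)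
    · rw [h]
      refine lintegral_congr fun s => ?_
      have hm : Measurable fun z : ℝ => if -x ≤ psum s k + z then φ (psum s k + z) else 0 :=
        Measurable.ite (measurableSet_le measurable_const (by fun_prop)) (by fun_prop)
          measurable_const
      have hk : Measurable fun s : ℕ → ℝ => s k := measurable_pi_apply k
      refine Eq.trans ?_ (lintegral_const_mul _ (hm.comp hk)).symm
      rw [killedOp]
      congr 1
      conv_lhs => rw [← map_coord (ν := ν) k]
      exact lintegral_map hm hk
    · refine lintegral_congr fun s => ?_
      rw [alive_succ, psum_succ]
      split_ifs <;> simp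

lemma tsum_ofReal_inv_sq_ne_top : ∑' a : ℕ, ENNReal.ofReal (((1 : ℝ) + a) ^ 2)⁻¹ ≠ ∞ := by
  have : Summable fun a : ℕ => (((1 : ℝ) + a) ^ 2)⁻¹ := by
    have := (summable_nat_add_iff 1).2 (Real.summable_nat_pow_inv.2 (one_lt_two))
    simpa [add_comm] using this
  exact this.tsum_ofReal_ne_top

/-- A weak form of the linear growth of the Green function of a random walk killed below `-x`, as a
function of the killing level. -/
theorem tsum_iterate_killedOp_le (h : ν (Set.Ioi 0) ≠ 0) :
    ∃ C : ℝ≥0∞, C ≠ ∞ ∧ ∀ x : ℝ, 0 ≤ x →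
      ∑' k, (killedOp ν x)^[k] (fun y => ENNReal.ofReal ((1 + (x + y)) ^ 2)⁻¹) 0 ≤
        C * ENNReal.ofReal (1 + x) := by
  obtain ⟨C, hC, hC'⟩ := tsum_killed_visit_le h
  set D : ℝ≥0∞ := ∑' a : ℕ, ENNReal.ofReal (((1 : ℝ) + a) ^ 2)⁻¹ with hD
  refine ⟨D * (C * 2), ENNReal.mul_ne_top tsum_ofReal_inv_sq_ne_top
    (ENNReal.mul_ne_top hC (by simp)), fun x hx => ?_⟩
  -- Lowering the killing level from `-x` to the integer `-n` only increases the number of visits.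
  set n := ⌈x⌉₊ with hn
  set E : ℕ → ℕ → Set (ℕ → ℝ) := fun a k =>
    {s | (∀ j ≤ k, -(n : ℝ) ≤ psum s j) ∧ psum s k ∈ Set.Ico (a - x) (a - x + 1)} with hE
  have hEm : ∀ a k, MeasurableSet (E a k) := by
    intro a k
    have : E a k = (⋂ j, ⋂ (_ : j ≤ k), {s | -(n : ℝ) ≤ psum s j}) ∩
        (fun s => psum s k) ⁻¹' Set.Ico (a - x) (a - x + 1) := by
      ext; simp [hE]
    rw [this]
    exact (MeasurableSet.iInter fun j => MeasurableSet.iInter fun _ =>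
      measurableSet_le measurable_const (measurable_psum j)).inter
        (measurable_psum k measurableSet_Ico)
  have hφ : Measurable fun y : ℝ => ENNReal.ofReal ((1 + (x + y)) ^ 2)⁻¹ := by fun_prop
  have hpt : ∀ k s, alive x k s * ENNReal.ofReal ((1 + (x + psum s k)) ^ 2)⁻¹ ≤
      ∑' a : ℕ, (E a k).indicator (fun _ => ENNReal.ofReal (((1 : ℝ) + a) ^ 2)⁻¹) s := by
    intro k s
    unfold alive
    split_ifs with hs
    · have h0 : 0 ≤ x + psum s k := by linarith [hs k le_rfl]
      -- Unit cells are indexed by the height `a` above `-x`; on cell `a` the test function is at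
      -- most `(1 + a)^{-2}`, which is summable.
      have hmem : s ∈ E ⌊x + psum s k⌋₊ k := by
        refine ⟨fun j hj => ?_, ?_, ?_⟩
        · have := hs j hj
          have := Nat.le_ceil x
          linarith
        · linarith [Nat.floor_le h0]
        · linarith [Nat.lt_floor_add_one (x + psum s k)]
      refine le_trans ?_ (ENNReal.le_tsum ⌊x + psum s k⌋₊)
      rw [Set.indicator_of_mem hmem, one_mul]
      apply ENNReal.ofReal_le_ofReal
      have := Nat.floor_le h0
      gcongr
    · simp
  calc _ = ∑' k, ∫⁻ s, alive x k s * ENNReal.ofReal ((1 + (x + psum s k)) ^ 2)⁻¹ ∂(seqLaw ν) :=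
        tsum_congr fun k => iterate_killedOp_eq hx k hφ
    _ ≤ ∑' k, ∑' a : ℕ, ENNReal.ofReal (((1 : ℝ) + a) ^ 2)⁻¹ * seqLaw ν (E a k) := by
        refine ENNReal.tsum_le_tsum fun k => (lintegral_mono (hpt k)).trans ?_
        rw [lintegral_tsum fun a => (measurable_const.indicator (hEm a k)).aemeasurable]
        refine ENNReal.tsum_le_tsum fun a => ?_
        rw [lintegral_indicator_const (hEm a k)]
    _ = ∑' a : ℕ, ENNReal.ofReal (((1 : ℝ) + a) ^ 2)⁻¹ * ∑' k, seqLaw ν (E a k) := by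
        rw [ENNReal.tsum_comm]
        exact tsum_congr fun a => ENNReal.tsum_mul_left
    _ ≤ ∑' a : ℕ, ENNReal.ofReal (((1 : ℝ) + a) ^ 2)⁻¹ * (C * (n + 1)) :=
        ENNReal.tsum_le_tsum fun a => by gcongr; exact hC' n _
    _ ≤ D * (C * 2) * ENNReal.ofReal (1 + x) := by
        rw [ENNReal.tsum_mul_right, ← hD, mul_assoc, mul_assoc]
        gcongr
        -- This gives `n + 1 < x + 2 ≤ 2 (1 + x)`, the origin of the factor `2`.
        have h1 := Nat.ceil_lt_add_one hx
        rw [← hn] at h1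
        have h2 : (2 : ℝ≥0∞) = ENNReal.ofReal 2 := by simp
        have h3 : (n : ℝ≥0∞) + 1 = ENNReal.ofReal (n + 1) := by
          rw [ENNReal.ofReal_add (by positivity) (by positivity)]
          simp
        rw [h2, h3, ← ENNReal.ofReal_mul (by norm_num)]
        apply ENNReal.ofReal_le_ofReal
        linarith

end RandomWalk
end BRW

/-! ### Weighted cascades, the many-to-one formula and the exceedance bound. -/

namespace BRW

/-- In `ℂ` summability is absolute summability, a measurable condition; off that set the sum is `0`
by convention, and on it the sum is a limit of finite sums. -/
lemma measurable_tsum_complex {ι : Type*} [Countable ι] :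
    Measurable fun x : ι → ℂ => ∑' j, x j := by
  classical
  obtain ⟨F, hF⟩ := exists_seq_tendsto (atTop : Filter (Finset ι))
  set S : Set (ι → ℂ) := {x | ∑' j, ‖x j‖ₑ ≠ ∞} with hS
  have hSm : MeasurableSet S := by
    have : Measurable fun x : ι → ℂ => ∑' j, ‖x j‖ₑ :=
      Measurable.tsum fun j => (measurable_pi_apply j).enorm
    exact this (measurableSet_singleton ∞).compl
  have hiff : ∀ x : ι → ℂ, x ∈ S ↔ Summable x := fun x => by
    rw [← summable_norm_iff]
    exact tsum_enorm_ne_top_iff_summable_norm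
  refine measurable_of_tendsto_metrizable
    (f := fun n x => S.indicator (fun x => ∑ j ∈ F n, x j) x) (fun n => ?_) ?_
  · exact (Finset.measurable_sum _ fun j _ => measurable_pi_apply j).indicator hSm
  · rw [tendsto_pi_nhds]
    intro x
    by_cases hx : x ∈ S
    · simp only [Set.indicator_of_mem hx]
      exact ((hiff x).1 hx).hasSum.comp hF
    · simp only [Set.indicator_of_notMem hx, tsum_eq_zero_of_not_summable (mt (hiff x).2 hx)]
      exact tendsto_const_nhds

/-- The words of length `n`. -/
abbrev Gen (n : ℕ) : Type := {u : List ℕ // u.length = n}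

/-- Appending a letter. -/
def genSuccEquiv (n : ℕ) : Gen n × ℕ ≃ Gen (n + 1) where
  toFun p := ⟨p.2 :: p.1.1, by simp [p.1.2]⟩
  invFun u := (⟨u.1.tail, by simp [u.2]⟩, u.1.headD 0)
  left_inv p := by simp
  right_inv u := by
    obtain ⟨u, hu⟩ := u
    cases u with
    | nil => simp at hu
    | cons j u => simp

lemma tsum_gen_succ (n : ℕ) (f : List ℕ → ℝ≥0∞) :
    ∑' u : Gen (n + 1), f u = ∑' u : Gen n, ∑' j, f (j :: u.1) := by
  rw [← (genSuccEquiv n).tsum_eq, ENNReal.tsum_prod']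
  rfl

lemma genZero_default (u : Gen 0) : u = ⟨[], rfl⟩ :=
  Subtype.ext (List.length_eq_zero_iff.1 u.2)

lemma tsum_gen_zero {E : Type*} [AddCommMonoid E] [TopologicalSpace E] [T2Space E]
    (f : List ℕ → E) : ∑' u : Gen 0, f u = f [] := by
  rw [tsum_eq_single ⟨[], rfl⟩]
  intro u hu
  exact absurd (genZero_default u) hu

lemma tsum_list_eq (f : List ℕ → ℝ≥0∞) : ∑' u, f u = ∑' n, ∑' u : Gen n, f u := by
  rw [← (Equiv.sigmaFiberEquiv (List.length (α := ℕ))).tsum_eq, ENNReal.tsum_sigma']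
  rfl

/-- A weighted branching process: the weights `w u j` attached to the edges of the tree of all words
are independent for distinct parents, and the distribution of the point process of the weights
attached to a parent, as far as it matters, does not depend on the parent. -/
structure IsCascade {Ω : Type*} [MeasurableSpace Ω] (P : Measure Ω) (w : List ℕ → ℕ → Ω → ℂ) :
    Prop where
  measurable : ∀ u j, Measurable (w u j)
  indep : iIndepFun (fun (u : List ℕ) (ω : Ω) (j : ℕ) => w u j ω) P
  lintegral_eq : ∀ (u : List ℕ) (F : ℂ → ℝ≥0∞), Measurable F → F 0 = 0 →
    ∫⁻ ω, ∑' j, F (w u j ω) ∂P = ∫⁻ ω, ∑' j, F (w [] j ω) ∂P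
  identDistrib : ∀ u : List ℕ,
    IdentDistrib (fun ω => ∑' j, w u j ω) (fun ω => ∑' j, w [] j ω) P P

/-- The weight of a word, with truncation `τ` applied at every step. -/
def node {Ω : Type*} (τ : ℂ → ℂ) (w : List ℕ → ℕ → Ω → ℂ) : List ℕ → Ω → ℂ
  | [], _ => 1
  | j :: u, ω => τ (node τ w u ω * w u j ω)

/-- The total weight of the edges below `u`. -/
noncomputable def total {Ω : Type*} (w : List ℕ → ℕ → Ω → ℂ) (u : List ℕ) (ω : Ω) : ℂ :=
  ∑' j, w u j ω

/-- The weights of the edges below `u`. -/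
def row {Ω : Type*} (w : List ℕ → ℕ → Ω → ℂ) (u : List ℕ) (ω : Ω) (j : ℕ) : ℂ := w u j ω

open Classical in
/-- Truncation at level `t`. -/
noncomputable def trunc (t : ℝ) (z : ℂ) : ℂ := if ‖z‖ ≤ t then z else 0

lemma measurable_trunc (t : ℝ) : Measurable (trunc t) :=
  Measurable.ite (measurableSet_le measurable_norm measurable_const) measurable_id measurable_const

lemma norm_trunc_le {t : ℝ} (ht : 0 ≤ t) (z : ℂ) : ‖trunc t z‖ ≤ t := by
  unfold trunc
  split_ifs with h
  · exact h
  · simpa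

@[simp] lemma trunc_zero (t : ℝ) : trunc t 0 = 0 := by simp [trunc]

variable {Ω : Type*} [mΩ : MeasurableSpace Ω] {P : Measure Ω} {w : List ℕ → ℕ → Ω → ℂ}

namespace IsCascade

lemma measurable_row (hw : IsCascade P w) (u : List ℕ) : Measurable (row w u) :=
  measurable_pi_lambda _ fun j => hw.measurable u j

lemma sigmaOf_row_le (hw : IsCascade P w) (S : Set (List ℕ)) : sigmaOf (row w) S ≤ mΩ :=
  sigmaOf_le hw.measurable_row S

omit mΩ in
lemma measurable_weight_sigmaOf {S : Set (List ℕ)} {u : List ℕ} (hu : u ∈ S) (j : ℕ) :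
    Measurable[sigmaOf (row w) S] (w u j) :=
  (measurable_pi_apply j).comp (measurable_sigmaOf (X := row w) hu)

omit mΩ in
lemma measurable_total_sigmaOf {S : Set (List ℕ)} {u : List ℕ} (hu : u ∈ S) :
    Measurable[sigmaOf (row w) S] (total w u) :=
  measurable_tsum_complex.comp (measurable_sigmaOf (X := row w) hu)

lemma measurable_total (hw : IsCascade P w) (u : List ℕ) : Measurable (total w u) :=
  measurable_tsum_complex.comp (hw.measurable_row u)

omit mΩ in
lemma measurable_node_sigmaOf {τ : ℂ → ℂ} (hτ : Measurable τ) {S : Set (List ℕ)} {u : List ℕ}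
    (hS : ∀ v : List ℕ, v.length < u.length → v ∈ S) :
    Measurable[sigmaOf (row w) S] (node τ w u) := by
  induction u with
  | nil => exact @measurable_const _ _ _ (sigmaOf _ _) _
  | cons j u ih =>
    refine hτ.comp (Measurable.mul (ih fun v hv => hS v (by simp; omega)) ?_)
    exact measurable_weight_sigmaOf (hS u (by simp)) j

lemma measurable_node (hw : IsCascade P w) {τ : ℂ → ℂ} (hτ : Measurable τ) (u : List ℕ) :
    Measurable (node τ w u) :=
  (measurable_node_sigmaOf hτ (S := Set.univ) fun _ _ => trivial).mono (hw.sigmaOf_row_le _) le_rfl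

lemma indepFun_row (hw : IsCascade P w) {S : Set (List ℕ)} {u : List ℕ} (hu : u ∉ S) {γ : Type*}
    [MeasurableSpace γ] {f : Ω → γ} (hf : Measurable[sigmaOf (row w) S] f) :
    IndepFun f (row w u) P :=
  indepFun_of_sigmaOf hw.measurable_row hw.indep (S := S) (T := {u})
    (Set.disjoint_singleton_right.2 hu) hf (measurable_sigmaOf (X := row w) rfl)

lemma indepFun_node_row (hw : IsCascade P w) {τ : ℂ → ℂ} (hτ : Measurable τ) (u : List ℕ) :
    IndepFun (node τ w u) (row w u) P :=
  hw.indepFun_row (S := {v | v.length < u.length}) (by simp)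
    (measurable_node_sigmaOf hτ fun _ h => h)

variable [IsProbabilityMeasure P]

/-- The branching property: given `f`, the weights below `u` may be replaced by an independent copy
of those below the root. Only sums of a function vanishing at `0` are transferred, since the
enumeration of the children may have a different law and absent children carry weight `0`. -/
lemma lintegral_tsum_weight (hw : IsCascade P w) {u : List ℕ} {γ : Type*}
    [MeasurableSpace γ] {f : Ω → γ} (hfm : Measurable f) (hf : IndepFun f (row w u) P)
    {g : γ → ℂ → ℝ≥0∞} (hg : Measurable fun p : γ × ℂ => g p.1 p.2) (hg0 : ∀ c, g c 0 = 0) :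
    ∫⁻ ω, ∑' j, g (f ω) (w u j ω) ∂P = ∫⁻ ω, ∫⁻ ω', ∑' j, g (f ω) (w [] j ω') ∂P ∂P := by
  have hG : Measurable fun p : γ × (ℕ → ℂ) => ∑' j, g p.1 (p.2 j) :=
    Measurable.tsum fun j => hg.comp
      (measurable_fst.prodMk ((measurable_pi_apply j).comp measurable_snd))
  refine (lintegral_indepFun hfm (hw.measurable_row u) hf hG).trans ?_
  refine lintegral_congr fun ω => ?_
  exact hw.lintegral_eq u (g (f ω)) (hg.comp measurable_prodMk_left) (hg0 _)

lemma lintegral_total (hw : IsCascade P w) {u : List ℕ} {γ : Type*}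
    [MeasurableSpace γ] {f : Ω → γ} (hfm : Measurable f) (hf : IndepFun f (row w u) P)
    {g : γ → ℂ → ℝ≥0∞} (hg : Measurable fun p : γ × ℂ => g p.1 p.2) :
    ∫⁻ ω, g (f ω) (total w u ω) ∂P = ∫⁻ ω, ∫⁻ ω', g (f ω) (total w [] ω') ∂P ∂P := by
  refine (lintegral_indepFun hfm (hw.measurable_total u)
    (hf.comp measurable_id measurable_tsum_complex) hg).trans ?_
  refine lintegral_congr fun ω => ?_
  exact ((hw.identDistrib u).comp (hg.comp measurable_prodMk_left)).lintegral_eq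

end IsCascade

/-- The law of `-log ‖w‖` under the measure tilted by `‖w‖ ^ α`. -/
noncomputable def stepLaw (P : Measure Ω) (w : List ℕ → ℕ → Ω → ℂ) (α : ℝ) : Measure ℝ :=
  Measure.sum fun j => (P.withDensity fun ω => ‖w [] j ω‖ₑ ^ α).map fun ω => -Real.log ‖w [] j ω‖

instance [SFinite P] (α : ℝ) : SFinite (stepLaw P w α) := by
  unfold stepLaw; infer_instance

namespace IsCascade

lemma lintegral_stepLaw (hw : IsCascade P w) (α : ℝ) {f : ℝ → ℝ≥0∞} (hf : Measurable f) :
    ∫⁻ x, f x ∂(stepLaw P w α) = ∫⁻ ω, ∑' j, ‖w [] j ω‖ₑ ^ α * f (-Real.log ‖w [] j ω‖) ∂P := by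
  have h1 : ∀ j, Measurable fun ω => -Real.log ‖w [] j ω‖ := fun j =>
    (Real.measurable_log.comp (hw.measurable [] j).norm).neg
  have h2 : ∀ j, Measurable fun ω => ‖w [] j ω‖ₑ ^ α := fun j =>
    (hw.measurable [] j).enorm.pow_const α
  rw [stepLaw, lintegral_sum_measure, lintegral_tsum]
  · refine tsum_congr fun j => ?_
    rw [lintegral_map hf (h1 j)]
    exact lintegral_withDensity_eq_lintegral_mul _ (h2 j) (hf.comp (h1 j))
  · exact fun j => ((h2 j).mul (hf.comp (h1 j))).aemeasurable

lemma stepLaw_apply (hw : IsCascade P w) (α : ℝ) {A : Set ℝ} (hA : MeasurableSet A) :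
    stepLaw P w α A =
      ∫⁻ ω, ∑' j, ‖w [] j ω‖ₑ ^ α * A.indicator 1 (-Real.log ‖w [] j ω‖) ∂P := by
  rw [← lintegral_indicator_one hA, hw.lintegral_stepLaw α (measurable_one.indicator hA)]

lemma isProbabilityMeasure_stepLaw (hw : IsCascade P w) {α : ℝ}
    (h : ∫⁻ ω, ∑' j, ‖w [] j ω‖ₑ ^ α ∂P = 1) : IsProbabilityMeasure (stepLaw P w α) :=
  ⟨by rw [hw.stepLaw_apply α MeasurableSet.univ]; simpa using h⟩

variable [IsProbabilityMeasure P]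

lemma lintegral_gen_succ (hw : IsCascade P w) {τ : ℂ → ℂ} (hτ : Measurable τ) (hτ0 : τ 0 = 0)
    {F : ℂ → ℝ≥0∞} (hF : Measurable F) (hF0 : F 0 = 0) (k : ℕ) :
    ∑' u : Gen (k + 1), ∫⁻ ω, F (node τ w u ω) ∂P =
      ∑' u : Gen k, ∫⁻ ω, ∫⁻ ω', ∑' j, F (τ (node τ w u ω * w [] j ω')) ∂P ∂P := by
  rw [tsum_gen_succ k fun u => ∫⁻ ω, F (node τ w u ω) ∂P]
  refine tsum_congr fun u => ?_
  refine (lintegral_tsum fun j => (hF.comp (hw.measurable_node hτ (j :: u.1))).aemeasurable).symm.trans ?_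
  exact hw.lintegral_tsum_weight (hw.measurable_node hτ u) (hw.indepFun_node_row hτ u.1)
    (g := fun z x => F (τ (z * x))) (hF.comp (hτ.comp (measurable_fst.mul measurable_snd)))
    (fun c => by simp [hτ0, hF0])

/-- By independence each generation contributes one factor. With `p = 1` this gives absolute
summability within every generation. -/
lemma lintegral_gen_id (hw : IsCascade P w) {p : ℝ} (hp : 0 < p) (n : ℕ) :
    ∑' u : Gen n, ∫⁻ ω, ‖node id w u ω‖ₑ ^ p ∂P = (∫⁻ ω, ∑' j, ‖w [] j ω‖ₑ ^ p ∂P) ^ n := by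
  induction n with
  | zero => rw [tsum_gen_zero fun u => ∫⁻ ω, ‖node id w u ω‖ₑ ^ p ∂P]; simp [node]
  | succ n ih =>
    rw [hw.lintegral_gen_succ measurable_id rfl (F := fun z => ‖z‖ₑ ^ p) (by fun_prop)
      (by simp [hp]), pow_succ, ← ih, ← ENNReal.tsum_mul_right]
    refine tsum_congr fun u => ?_
    rw [← lintegral_mul_const _ ((hw.measurable_node measurable_id _).enorm.pow_const p)]
    refine lintegral_congr fun ω => ?_
    rw [← lintegral_const_mul _ (Measurable.tsum fun j => (hw.measurable [] j).enorm.pow_const p)]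
    refine lintegral_congr fun ω' => ?_
    rw [← ENNReal.tsum_mul_left]
    refine tsum_congr fun j => ?_
    rw [id, enorm_mul, ENNReal.mul_rpow_of_nonneg _ _ hp.le]

/-- The many-to-one formula for the weights truncated at level `t`. -/
theorem lintegral_gen_trunc (hw : IsCascade P w) {α : ℝ} (hα : 0 < α) {t : ℝ} (ht : 0 < t)
    {φ : ℝ → ℝ≥0∞} (hφ : Measurable φ) (k : ℕ) :
    ∑' u : Gen k, ∫⁻ ω, ‖node (trunc t) w u ω‖ₑ ^ α * φ (-Real.log ‖node (trunc t) w u ω‖) ∂P =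
      (RandomWalk.killedOp (stepLaw P w α) (Real.log t))^[k] φ 0 := by
  induction k generalizing φ with
  | zero =>
    rw [tsum_gen_zero fun u => ∫⁻ ω, ‖node (trunc t) w u ω‖ₑ ^ α *
      φ (-Real.log ‖node (trunc t) w u ω‖) ∂P]
    simp [node]
  | succ k ih =>
    have hlog : Measurable fun z : ℂ => -Real.log ‖z‖ :=
      (Real.measurable_log.comp measurable_norm).neg
    rw [Function.iterate_succ_apply, ← ih (RandomWalk.measurable_killedOp _ hφ),
      hw.lintegral_gen_succ (measurable_trunc t) (trunc_zero t)
        (F := fun z => ‖z‖ₑ ^ α * φ (-Real.log ‖z‖))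
        ((measurable_enorm.pow_const α).mul (hφ.comp hlog)) (by simp [hα])]
    refine tsum_congr fun u => lintegral_congr fun ω => ?_
    generalize node (trunc t) w u ω = z
    -- The logarithm of `0` has a default value, harmless because the factor `‖z‖ₑ ^ α` vanishes.
    rcases eq_or_ne z 0 with rfl | hz
    · simp [hα]
    have hm : Measurable fun x => if -Real.log t ≤ -Real.log ‖z‖ + x then
        φ (-Real.log ‖z‖ + x) else 0 :=
      Measurable.ite (measurableSet_le measurable_const (by fun_prop)) (by fun_prop)
        measurable_const
    rw [RandomWalk.killedOp, hw.lintegral_stepLaw α hm, ← lintegral_const_mul]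
    · refine lintegral_congr fun ω' => ?_
      rw [← ENNReal.tsum_mul_left]
      refine tsum_congr fun j => ?_
      generalize w [] j ω' = x
      rcases eq_or_ne x 0 with rfl | hx
      · simp [hα]
      have hz' : 0 < ‖z‖ := norm_pos_iff.2 hz
      have hx' : 0 < ‖x‖ := norm_pos_iff.2 hx
      -- Truncation at `t` is killing below `-log t` on the logarithmic scale.
      have hiff : ‖z * x‖ ≤ t ↔ -Real.log t ≤ -Real.log ‖z‖ + -Real.log ‖x‖ := by
        rw [norm_mul, ← Real.log_le_log_iff (by positivity) ht, Real.log_mul hz'.ne' hx'.ne']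
        constructor <;> intro h <;> linarith
      unfold trunc
      by_cases h : ‖z * x‖ ≤ t
      · rw [if_pos h, if_pos (hiff.1 h), norm_mul, Real.log_mul hz'.ne' hx'.ne', enorm_mul,
          ENNReal.mul_rpow_of_nonneg _ _ hα.le, mul_assoc, neg_add]
      · rw [if_neg h, if_neg (mt hiff.2 h)]
        simp [hα]
    · exact Measurable.tsum fun j => ((hw.measurable [] j).enorm.pow_const α).mul
        (hm.comp (hlog.comp (hw.measurable [] j)))

/-- With high probability no weight exceeds `t`. -/
theorem measure_exceed_le (hw : IsCascade P w) {α : ℝ} (hα : 0 < α)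
    (h1 : ∫⁻ ω, ∑' j, ‖w [] j ω‖ₑ ^ α ∂P = 1) {t : ℝ} (ht : 0 < t) :
    P {ω | ∃ u j, t < ‖node (trunc t) w u ω * w u j ω‖} ≤ ENNReal.ofReal (t ^ (-α)) := by
  classical
  set τ := trunc t with hτ
  have hτm : Measurable τ := measurable_trunc t
  set E : ℂ → ℝ≥0∞ := fun z => if t < ‖z‖ then ‖z‖ₑ ^ α else 0 with hE
  have hEm : Measurable E := Measurable.ite (measurableSet_lt measurable_const measurable_norm)
    (measurable_enorm.pow_const α) measurable_const
  have hE0 : E 0 = 0 := by simp [hE, hα]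
  set a : ℕ → ℝ≥0∞ := fun k => ∑' u : Gen k, ∫⁻ ω, ‖node τ w u ω‖ₑ ^ α ∂P with ha
  set b : ℕ → ℝ≥0∞ := fun k =>
    ∑' u : Gen k, ∫⁻ ω, ∫⁻ ω', ∑' j, E (node τ w u ω * w [] j ω') ∂P ∂P with hb
  -- Conservation of `α`-mass: what survives to generation `k` either crosses `t` at the next step
  -- (`b k`) or survives once more. As the initial mass is 1, the crossing masses sum to at most 1.
  have hab : ∀ k, b k + a (k + 1) = a k := by
    intro k
    simp only [ha, hb]
    rw [hw.lintegral_gen_succ hτm (trunc_zero t) (F := fun z => ‖z‖ₑ ^ α) (by fun_prop)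
      (by simp [hα]), ← ENNReal.tsum_add]
    refine tsum_congr fun u => ?_
    have hmz : ∀ F : ℂ → ℝ≥0∞, Measurable F → Measurable fun ω => ∫⁻ ω', ∑' j,
        F (node τ w u ω * w [] j ω') ∂P := fun F hF => by
      have : Measurable fun p : Ω × Ω => ∑' j, F (node τ w u p.1 * w [] j p.2) :=
        Measurable.tsum fun j => hF.comp (((hw.measurable_node hτm _).comp measurable_fst).mul
          ((hw.measurable [] j).comp measurable_snd))
      exact this.lintegral_prod_right'
    rw [← lintegral_add_left (hmz E hEm)]
    refine lintegral_congr fun ω => ?_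
    generalize node τ w u ω = z
    refine (lintegral_add_left (Measurable.tsum fun j =>
      hEm.comp ((hw.measurable [] j).const_mul z)) _).symm.trans ?_
    trans ∫⁻ ω', ‖z‖ₑ ^ α * ∑' j, ‖w [] j ω'‖ₑ ^ α ∂P
    · refine lintegral_congr fun ω' => ?_
      rw [← ENNReal.tsum_mul_left, ← ENNReal.tsum_add]
      refine tsum_congr fun j => ?_
      rw [← ENNReal.mul_rpow_of_nonneg _ _ hα.le, ← enorm_mul]
      simp only [hE, hτ, trunc, Function.comp_apply]
      by_cases h : ‖z * w [] j ω'‖ ≤ t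
      · rw [if_pos h, if_neg (not_lt.2 h), zero_add]
      · rw [if_neg h, if_pos (not_le.1 h)]
        simp [hα]
    · rw [lintegral_const_mul _ (Measurable.tsum fun j => (hw.measurable [] j).enorm.pow_const α),
        h1, mul_one]
  have ha0 : a 0 = 1 := by
    simp only [ha]
    rw [tsum_gen_zero fun u => ∫⁻ ω, ‖node τ w u ω‖ₑ ^ α ∂P]
    simp [node]
  have hpart : ∀ n, (∑ k ∈ Finset.range n, b k) + a n = 1 := by
    intro n
    induction n with
    | zero => simp [ha0]
    | succ n ih => rw [Finset.sum_range_succ, add_assoc, hab, ih]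
  have hbsum : ∑' k, b k ≤ 1 := by
    rw [ENNReal.tsum_eq_iSup_nat]
    exact iSup_le fun n => (le_self_add).trans (hpart n).le
  have hb' : ∑' u : List ℕ, ∑' j, ∫⁻ ω, E (node τ w u ω * w u j ω) ∂P ≤ 1 := by
    rw [tsum_list_eq]
    refine le_trans (le_of_eq ?_) hbsum
    refine tsum_congr fun k => tsum_congr fun u => ?_
    refine (lintegral_tsum fun j => (hEm.comp ((hw.measurable_node hτm u.1).mul
      (hw.measurable u.1 j))).aemeasurable).symm.trans ?_
    exact hw.lintegral_tsum_weight (hw.measurable_node hτm u) (hw.indepFun_node_row hτm u.1)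
      (g := fun z x => E (z * x)) (hEm.comp (measurable_fst.mul measurable_snd))
      (fun c => by simp [hE0])
  have hset : {ω | ∃ u j, t < ‖node τ w u ω * w u j ω‖} =
      ⋃ u, ⋃ j, {ω | t < ‖node τ w u ω * w u j ω‖} := by
    ext; simp
  rw [hset]
  calc _ ≤ ∑' u, ∑' j, P {ω | t < ‖node τ w u ω * w u j ω‖} :=
        (measure_iUnion_le _).trans (ENNReal.tsum_le_tsum fun u => measure_iUnion_le _)
    -- Markov's inequality: a crossing carries `α`-mass at least `t ^ α`.
    _ ≤ ∑' u, ∑' j, ENNReal.ofReal (t ^ (-α)) * ∫⁻ ω, E (node τ w u ω * w u j ω) ∂P := by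
        refine ENNReal.tsum_le_tsum fun u => ENNReal.tsum_le_tsum fun j => ?_
        have hmm : Measurable fun ω => node τ w u ω * w u j ω :=
          (hw.measurable_node hτm _).mul (hw.measurable _ j)
        refine le_trans (le_of_eq (lintegral_indicator_one
          (measurableSet_lt measurable_const hmm.norm)).symm)
          (le_trans ?_ (lintegral_const_mul _ (hEm.comp hmm)).le)
        refine lintegral_mono fun ω => ?_
        simp only [Function.comp_apply]
        by_cases h : t < ‖node τ w u ω * w u j ω‖
        · rw [Set.indicator_of_mem (by exact h)]
          simp only [hE, if_pos h, Pi.one_apply]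
          rw [← ofReal_norm, ENNReal.ofReal_rpow_of_nonneg (norm_nonneg _) hα.le,
            ← ENNReal.ofReal_mul (by positivity), ENNReal.one_le_ofReal, Real.rpow_neg ht.le,
            ← div_eq_inv_mul, one_le_div (by positivity)]
          exact Real.rpow_le_rpow ht.le h.le hα.le
        · rw [Set.indicator_of_notMem (by exact h)]
          exact zero_le
    _ ≤ ENNReal.ofReal (t ^ (-α)) := by
        simp_rw [ENNReal.tsum_mul_left]
        exact mul_le_of_le_one_right' hb'

end IsCascade
end BRW

/-! ### Pointwise estimates for truncated increments, and tools for second moments. -/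

namespace BRW

lemma one_add_log_sq_le {β x : ℝ} (hβ : 0 < β) (hx : 1 ≤ x) :
    (1 + Real.log x) ^ 2 ≤ (1 + 2 / β) ^ 2 * x ^ β := by
  have h1 : Real.log x ≤ x ^ (β / 2) / (β / 2) :=
    Real.log_le_rpow_div (by linarith) (by positivity)
  have h2 : 1 ≤ x ^ (β / 2) := Real.one_le_rpow hx (by positivity)
  have h3 : (x ^ (β / 2)) ^ 2 = x ^ β := by
    rw [← Real.rpow_natCast, ← Real.rpow_mul (by linarith)]
    norm_num
  rw [← h3, ← mul_pow]
  have h4 := Real.log_nonneg hx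
  have h5 : x ^ (β / 2) / (β / 2) = 2 / β * x ^ (β / 2) := by field_simp
  gcongr
  rw [h5] at h1
  linarith

/-- Put `x = t / (l r) ≥ 1`. Then `(l r)² x^{2-α} = (l r)^α t^{2-α}`, and `log t - log l = log x +
log r` gives `1 + log t - log l ≤ (1 + log x)(1 + log₊ r)`. The power `x^{2-α}` absorbs `(1 + log
x)²` because `α < 2`. -/
lemma sq_mul_le_of_mul_le {α l r t : ℝ} (hα : α < 2) (hl : 0 < l) (hr : 0 < r)
    (h : l * r ≤ t) (hlt : l ≤ t) :
    (l * r) ^ 2 ≤ (1 + 2 / (2 - α)) ^ 2 * t ^ (2 - α) *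
      (l ^ α * ((1 + (Real.log t + -Real.log l)) ^ 2)⁻¹) *
      (r ^ α * (1 + max (Real.log r) 0) ^ 2) := by
  have ht : 0 < t := by linarith
  have hβ : 0 < 2 - α := by linarith
  have hx : 1 ≤ t / (l * r) := by rw [one_le_div (by positivity)]; exact h
  set x := t / (l * r) with hxd
  have hlx : Real.log t + -Real.log l = Real.log x + Real.log r := by
    rw [hxd, Real.log_div (by positivity) (by positivity), Real.log_mul hl.ne' hr.ne']
    ring
  have hLg : 0 ≤ Real.log t + -Real.log l := by linarith [Real.log_le_log hl hlt]
  set g := Real.log t + -Real.log l with hg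
  set q := max (Real.log r) 0 with hq
  have hq0 : 0 ≤ q := le_max_right _ _
  have hlogx := Real.log_nonneg hx
  have h1 : 1 + g ≤ (1 + Real.log x) * (1 + q) := by
    have := le_max_left (Real.log r) 0
    rw [← hq] at this
    nlinarith
  have h2 : (1 + g) ^ 2 ≤ ((1 + 2 / (2 - α)) ^ 2 * x ^ (2 - α)) * (1 + q) ^ 2 := by
    calc (1 + g) ^ 2 ≤ ((1 + Real.log x) * (1 + q)) ^ 2 := by gcongr
      _ = (1 + Real.log x) ^ 2 * (1 + q) ^ 2 := by ring
      _ ≤ _ := by gcongr; exact one_add_log_sq_le hβ hx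
  have h3 : (l * r) ^ 2 * x ^ (2 - α) = l ^ α * r ^ α * t ^ (2 - α) := by
    have : (l * r) ^ 2 = (l * r) ^ α * (l * r) ^ (2 - α) := by
      rw [← Real.rpow_add (by positivity), ← Real.rpow_natCast]
      norm_num
    rw [this, mul_assoc, ← Real.mul_rpow (by positivity) (by positivity), hxd,
      mul_div_cancel₀ _ (by positivity), Real.mul_rpow hl.le hr.le]
  have h4 : (l * r) ^ 2 * (1 + g) ^ 2 ≤
      (1 + 2 / (2 - α)) ^ 2 * t ^ (2 - α) * l ^ α * (r ^ α * (1 + q) ^ 2) := by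
    calc _ ≤ (l * r) ^ 2 * (((1 + 2 / (2 - α)) ^ 2 * x ^ (2 - α)) * (1 + q) ^ 2) := by gcongr
      _ = (1 + 2 / (2 - α)) ^ 2 * ((l * r) ^ 2 * x ^ (2 - α)) * (1 + q) ^ 2 := by ring
      _ = _ := by rw [h3]; ring
  have h5 : (l * r) ^ 2 ≤
      ((1 + 2 / (2 - α)) ^ 2 * t ^ (2 - α) * l ^ α * (r ^ α * (1 + q) ^ 2)) / (1 + g) ^ 2 := by
    rw [le_div_iff₀ (by positivity)]
    exact h4
  refine h5.trans (le_of_eq ?_)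
  field_simp

/-- Here `l r > t` forces `log₊ r ≥ log t - log l`, so the quotient of squared logarithms is at
least 1 and may be inserted. The power of `t` comes from `(l r)^{1-α} ≤ t^{1-α}`, valid as `α > 1`.
-/
lemma mul_le_of_lt_mul {α l r t : ℝ} (hα : 1 < α) (hl : 0 < l) (hr : 0 < r)
    (h : t < l * r) (hlt : l ≤ t) :
    l * r ≤ t ^ (1 - α) * (l ^ α * ((1 + (Real.log t + -Real.log l)) ^ 2)⁻¹) *
      (r ^ α * (1 + max (Real.log r) 0) ^ 2) := by
  have ht : 0 < t := by linarith
  have hLg : 0 ≤ Real.log t + -Real.log l := by linarith [Real.log_le_log hl hlt]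
  have h1 : Real.log t + -Real.log l ≤ max (Real.log r) 0 := by
    refine le_trans ?_ (le_max_left _ _)
    have := Real.log_le_log ht h.le
    rw [Real.log_mul hl.ne' hr.ne'] at this
    linarith
  set g := Real.log t + -Real.log l with hg
  set q := max (Real.log r) 0 with hq
  have h2 : l * r ≤ t ^ (1 - α) * (l ^ α * r ^ α) := by
    rw [← Real.mul_rpow hl.le hr.le]
    calc l * r = (l * r) ^ (1 - α) * (l * r) ^ α := by
          rw [← Real.rpow_add (by positivity)]
          norm_num
      _ ≤ _ := by
          gcongr ?_ * _
          exact Real.rpow_le_rpow_of_nonpos ht h.le (by linarith)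
  calc l * r ≤ t ^ (1 - α) * (l ^ α * r ^ α) * 1 := by rw [mul_one]; exact h2
    _ ≤ t ^ (1 - α) * (l ^ α * r ^ α) * ((1 + q) ^ 2 / (1 + g) ^ 2) := by
        gcongr
        rw [one_le_div (by positivity)]
        gcongr
    _ = _ := by field_simp

/-- The integrand of the moment condition. -/
noncomputable def logMomentFun (α : ℝ) (y : ℂ) : ℝ≥0∞ :=
  ENNReal.ofReal (‖y‖ ^ α * (1 + max (Real.log ‖y‖) 0) ^ 2)

/-- The weight function of the killed walk. -/
noncomputable def greenFun (α t : ℝ) (z : ℂ) : ℝ≥0∞ :=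
  ‖z‖ₑ ^ α * ENNReal.ofReal ((1 + (Real.log t + -Real.log ‖z‖)) ^ 2)⁻¹

lemma greenFun_eq {α t : ℝ} {z : ℂ} (hz : 0 < ‖z‖) : greenFun α t z =
    ENNReal.ofReal (‖z‖ ^ α * ((1 + (Real.log t + -Real.log ‖z‖)) ^ 2)⁻¹) := by
  rw [greenFun, ENNReal.ofReal_mul (by positivity), ← ofReal_norm,
    ENNReal.ofReal_rpow_of_pos hz]

lemma enorm_trunc_sq_le {α t : ℝ} (hα : α < 2) {z : ℂ} (hz : ‖z‖ ≤ t) (y : ℂ) :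
    ‖trunc t (z * y)‖ₑ ^ 2 ≤ ENNReal.ofReal ((1 + 2 / (2 - α)) ^ 2 * t ^ (2 - α)) *
      greenFun α t z * logMomentFun α y := by
  have ht : 0 ≤ t := (norm_nonneg z).trans hz
  by_cases h : z * y = 0 ∨ t < ‖z * y‖
  · have : trunc t (z * y) = 0 := by
      rcases h with h | h
      · rw [h, trunc_zero]
      · exact if_neg (not_le.2 h)
    simp [this]
  · push Not at h
    have hz0 : 0 < ‖z‖ := norm_pos_iff.2 (left_ne_zero_of_mul h.1)
    have hy0 : 0 < ‖y‖ := norm_pos_iff.2 (right_ne_zero_of_mul h.1)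
    have htr : trunc t (z * y) = z * y := if_pos h.2
    rw [htr, ← ofReal_norm, ← ENNReal.ofReal_pow (norm_nonneg _), greenFun_eq hz0, logMomentFun,
      ← ENNReal.ofReal_mul (by positivity), ← ENNReal.ofReal_mul (by positivity)]
    apply ENNReal.ofReal_le_ofReal
    rw [norm_mul]
    exact sq_mul_le_of_mul_le hα hz0 hy0 (by rw [← norm_mul]; exact h.2) hz

lemma enorm_sub_trunc_le {α t : ℝ} (hα : 1 < α) {z : ℂ} (hz : ‖z‖ ≤ t) (y : ℂ) :
    ‖z * y - trunc t (z * y)‖ₑ ≤ ENNReal.ofReal (t ^ (1 - α)) *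
      greenFun α t z * logMomentFun α y := by
  have ht : 0 ≤ t := (norm_nonneg z).trans hz
  by_cases h : ‖z * y‖ ≤ t
  · have : trunc t (z * y) = z * y := if_pos h
    simp [this]
  · have htr : trunc t (z * y) = 0 := if_neg h
    have h0 : z * y ≠ 0 := by rintro h0; simp [h0, ht] at h
    have hz0 : 0 < ‖z‖ := norm_pos_iff.2 (left_ne_zero_of_mul h0)
    have hy0 : 0 < ‖y‖ := norm_pos_iff.2 (right_ne_zero_of_mul h0)
    rw [htr, sub_zero, ← ofReal_norm, greenFun_eq hz0, logMomentFun,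
      ← ENNReal.ofReal_mul (by positivity), ← ENNReal.ofReal_mul (by positivity)]
    apply ENNReal.ofReal_le_ofReal
    rw [norm_mul]
    exact mul_le_of_lt_mul hα hz0 hy0 (by rw [← norm_mul]; exact not_le.1 h) hz

section Generic

variable {Ω : Type*} [mΩ : MeasurableSpace Ω] {P : Measure Ω}

/-- Fatou's lemma along a sequence of finite sets that exhausts `ι`. -/
lemma lintegral_tsum_sq_le {ι : Type*} [Countable ι] {f : ι → Ω → ℂ} (hf : ∀ i, Measurable (f i))
    (hs : ∀ᵐ ω ∂P, Summable fun i => f i ω) {B : ℝ≥0∞}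
    (hB : ∀ F : Finset ι, ∫⁻ ω, ‖∑ i ∈ F, f i ω‖ₑ ^ 2 ∂P ≤ B) :
    ∫⁻ ω, ‖∑' i, f i ω‖ₑ ^ 2 ∂P ≤ B := by
  obtain ⟨F, hF⟩ := exists_seq_tendsto (atTop : Filter (Finset ι))
  calc ∫⁻ ω, ‖∑' i, f i ω‖ₑ ^ 2 ∂P
      = ∫⁻ ω, liminf (fun n => ‖∑ i ∈ F n, f i ω‖ₑ ^ 2) atTop ∂P := by
        refine lintegral_congr_ae ?_
        filter_upwards [hs] with ω hω
        refine (Tendsto.liminf_eq ?_).symm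
        exact ((ENNReal.continuous_pow 2).tendsto _).comp ((hω.hasSum.comp hF).enorm)
    _ ≤ liminf (fun n => ∫⁻ ω, ‖∑ i ∈ F n, f i ω‖ₑ ^ 2 ∂P) atTop :=
        lintegral_liminf_le fun n =>
          ((Finset.measurable_sum _ fun i _ => hf i).enorm.pow_const 2)
    _ ≤ B := by
        refine liminf_le_of_le (by isBoundedDefault) fun b hb => ?_
        obtain ⟨n, hn⟩ := hb.exists
        exact hn.trans (hB _)

lemma lintegral_sum_sq_eq [IsFiniteMeasure P] {ι : Type*} {f : ι → Ω → ℂ}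
    (hf : ∀ i, MemLp (f i) 2 P)
    (horth : ∀ i j, i ≠ j → ∫ ω, (starRingEnd ℂ) (f i ω) * f j ω ∂P = 0) (F : Finset ι) :
    ∫⁻ ω, ‖∑ i ∈ F, f i ω‖ₑ ^ 2 ∂P = ∑ i ∈ F, ∫⁻ ω, ‖f i ω‖ₑ ^ 2 ∂P := by
  classical
  have hconv : ∀ g : Ω → ℂ, MemLp g 2 P →
      ∫⁻ ω, ‖g ω‖ₑ ^ 2 ∂P = ENNReal.ofReal (∫ ω, ‖g ω‖ ^ 2 ∂P) := by
    intro g hg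
    rw [ofReal_integral_eq_lintegral_ofReal hg.norm.integrable_sq
      (Eventually.of_forall fun ω => by positivity)]
    refine lintegral_congr fun ω => ?_
    rw [ENNReal.ofReal_pow (norm_nonneg _), ofReal_norm]
  have hint : ∀ i j, Integrable (fun ω => (starRingEnd ℂ) (f i ω) * f j ω) P := fun i j =>
    MemLp.integrable_mul (p := 2) (q := 2) (hf i).star (hf j)
  have hsum : MemLp (fun ω => ∑ i ∈ F, f i ω) 2 P := memLp_finsetSum F fun i _ => hf i
  rw [hconv _ hsum, Finset.sum_congr rfl fun i _ => hconv _ (hf i),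
    ← ENNReal.ofReal_sum_of_nonneg fun i _ => integral_nonneg fun ω => by positivity]
  congr 1
  have key : ((∫ ω, ‖∑ i ∈ F, f i ω‖ ^ 2 ∂P : ℝ) : ℂ) = ((∑ i ∈ F, ∫ ω, ‖f i ω‖ ^ 2 ∂P : ℝ) : ℂ) := by
    rw [← integral_complex_ofReal]
    push_cast
    simp_rw [← Complex.conj_mul', map_sum, Finset.sum_mul_sum]
    rw [integral_finsetSum _ fun i _ => integrable_finsetSum _ fun j _ => hint i j]
    refine Finset.sum_congr rfl fun i hi => ?_
    rw [integral_finsetSum _ fun j _ => hint i j, Finset.sum_eq_single i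
      (fun j _ hj => horth i j hj.symm) (fun h => absurd hi h), ← integral_complex_ofReal]
    refine integral_congr_ae (Eventually.of_forall fun ω => ?_)
    simp [Complex.conj_mul']
  exact_mod_cast key

lemma integral_indepFun_eq_zero [IsFiniteMeasure P] {γ δ : Type*} [MeasurableSpace γ]
    [MeasurableSpace δ] {U : Ω → γ} {V : Ω → δ} (hU : Measurable U) (hV : Measurable V)
    (h : IndepFun U V P) {G : γ × δ → ℂ} (hG : Measurable G)
    (h0 : ∀ c, ∫ ω, G (c, V ω) ∂P = 0) : ∫ ω, G (U ω, V ω) ∂P = 0 := by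
  have hUV := hU.prodMk hV
  rw [← integral_map (φ := fun ω => (U ω, V ω)) (f := G) hUV.aemeasurable
    hG.aestronglyMeasurable,
    (indepFun_iff_map_prod_eq_prod_map_map hU.aemeasurable hV.aemeasurable).1 h]
  by_cases hi : Integrable G ((P.map U).prod (P.map V))
  · rw [integral_prod _ hi]
    refine integral_eq_zero_of_ae (Eventually.of_forall fun c => ?_)
    have hGc : Measurable fun y => G (c, y) := hG.comp measurable_prodMk_left
    simp only [Pi.zero_apply]
    rw [integral_map hV.aemeasurable hGc.aestronglyMeasurable, h0]
  -- No integrability is required: the integral of a non-integrable function is `0` by convention.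
  · exact integral_undef hi

lemma enorm_integral_sq_le [IsProbabilityMeasure P] {f : Ω → ℂ} (hf : AEStronglyMeasurable f P) :
    ‖∫ ω, f ω ∂P‖ₑ ^ 2 ≤ ∫⁻ ω, ‖f ω‖ₑ ^ 2 ∂P := by
  have h1 : ‖∫ ω, f ω ∂P‖ₑ ≤ eLpNorm f 2 P :=
    (enorm_integral_le_lintegral_enorm f).trans (by
      rw [← eLpNorm_one_eq_lintegral_enorm]
      exact eLpNorm_le_eLpNorm_of_exponent_le (by norm_num) hf)
  refine (pow_le_pow_left' h1 2).trans (le_of_eq ?_)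
  rw [eLpNorm_eq_lintegral_rpow_enorm_toReal (by norm_num) (by norm_num)]
  rw [← ENNReal.rpow_natCast, ← ENNReal.rpow_mul]
  simp

end Generic

end BRW

/-! ### Cascades at the boundary: moments and orthogonality of the truncated increments. -/

namespace BRW

/-- A cascade at the boundary: the exponent `α ∈ (1, 2)` is characteristic for the weights, and the
total weight of the first generation has a moment of order `α` with a squared logarithm. -/
structure IsBoundaryCascade {Ω : Type*} [MeasurableSpace Ω] (P : Measure Ω)
    (w : List ℕ → ℕ → Ω → ℂ) (α : ℝ) : Prop extends IsCascade P w where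
  one_lt : 1 < α
  lt_two : α < 2
  lintegral_rpow : ∫⁻ ω, ∑' j, ‖w [] j ω‖ₑ ^ α ∂P = 1
  lintegral_enorm : ∫⁻ ω, ∑' j, ‖w [] j ω‖ₑ ∂P ≠ ∞
  integral_total : ∫ ω, total w [] ω ∂P = 1
  lintegral_logMoment : ∫⁻ ω, logMomentFun α (total w [] ω - 1) ∂P ≠ ∞
  stepLaw_pos : stepLaw P w α (Set.Ioi 0) ≠ 0

variable {Ω : Type*} [mΩ : MeasurableSpace Ω] {P : Measure Ω} [IsProbabilityMeasure P]
  {w : List ℕ → ℕ → Ω → ℂ} {α : ℝ}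

/-- The mean of the truncated increment below an individual of weight `z`. -/
noncomputable def center (P : Measure Ω) (w : List ℕ → ℕ → Ω → ℂ) (t : ℝ) (z : ℂ) : ℂ :=
  ∫ ω, trunc t (z * (total w [] ω - 1)) ∂P

/-- The increment below `u`, truncated and centered. -/
noncomputable def smallPart (P : Measure Ω) (w : List ℕ → ℕ → Ω → ℂ) (t : ℝ) (u : List ℕ) (ω : Ω) :
    ℂ :=
  trunc t (node (trunc t) w u ω * (total w u ω - 1)) - center P w t (node (trunc t) w u ω)

/-- The remainder of the increment below `u`. -/
noncomputable def bigPart (P : Measure Ω) (w : List ℕ → ℕ → Ω → ℂ) (t : ℝ) (u : List ℕ) (ω : Ω) :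
    ℂ :=
  node (trunc t) w u ω * (total w u ω - 1) - smallPart P w t u ω

omit mΩ in
lemma norm_node_trunc_le {t : ℝ} (ht : 1 ≤ t) (u : List ℕ) (ω : Ω) :
    ‖node (trunc t) w u ω‖ ≤ t := by
  cases u with
  | nil => simpa [node] using ht
  | cons j u => exact norm_trunc_le (by linarith) _

lemma measurable_logMomentFun (α : ℝ) : Measurable (logMomentFun α) := by
  unfold logMomentFun
  exact ((measurable_norm.pow_const α).mul (((((Real.measurable_log.comp measurable_norm)).max
    measurable_const).const_add 1).pow_const 2)).ennreal_ofReal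

lemma measurable_greenFun (α t : ℝ) : Measurable (greenFun α t) := by
  unfold greenFun
  exact (measurable_enorm.pow_const α).mul ((((((Real.measurable_log.comp
    measurable_norm).neg).const_add _).const_add 1).pow_const 2).inv).ennreal_ofReal

lemma enorm_sub_sq_le (a b : ℂ) : ‖a - b‖ₑ ^ 2 ≤ 4 * (‖a‖ₑ ^ 2 + ‖b‖ₑ ^ 2) := by
  have h : ∀ x y : ℝ≥0∞, x ≤ y → (x + y) ^ 2 ≤ 4 * (x ^ 2 + y ^ 2) := fun x y hxy => by
    calc (x + y) ^ 2 ≤ (y + y) ^ 2 := by gcongr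
      _ = 4 * y ^ 2 := by ring
      _ ≤ 4 * (x ^ 2 + y ^ 2) := by gcongr; exact le_add_self
  refine (pow_le_pow_left' (enorm_sub_le (a := a) (b := b)) 2).trans ?_
  rcases le_total ‖a‖ₑ ‖b‖ₑ with h' | h'
  · exact h _ _ h'
  · rw [add_comm ‖a‖ₑ, add_comm (‖a‖ₑ ^ 2)]
    exact h _ _ h'

namespace IsBoundaryCascade

omit [IsProbabilityMeasure P] in
lemma integrable_total (hw : IsBoundaryCascade P w α) : Integrable (total w []) P := by
  refine ⟨(hw.measurable_total []).aestronglyMeasurable, ?_⟩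
  refine lt_of_le_of_lt (lintegral_mono fun ω => ?_) hw.lintegral_enorm.lt_top
  exact enorm_tsum_le_tsum_enorm

lemma measurable_center (hw : IsBoundaryCascade P w α) (t : ℝ) : Measurable (center P w t) := by
  have : Measurable fun p : ℂ × Ω => trunc t (p.1 * (total w [] p.2 - 1)) :=
    (measurable_trunc t).comp (measurable_fst.mul
      (((hw.measurable_total []).comp measurable_snd).sub_const 1))
  exact this.stronglyMeasurable.integral_prod_right'.measurable

lemma measurable_smallPart_sigmaOf (hw : IsBoundaryCascade P w α) (t : ℝ) {u : List ℕ}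
    {S : Set (List ℕ)} (hu : u ∈ S) (hS : ∀ v : List ℕ, v.length < u.length → v ∈ S) :
    Measurable[sigmaOf (row w) S] (smallPart P w t u) := by
  have h1 : Measurable[sigmaOf (row w) S] (node (trunc t) w u) :=
    IsCascade.measurable_node_sigmaOf (measurable_trunc t) hS
  have h2 : Measurable[sigmaOf (row w) S] (total w u) := IsCascade.measurable_total_sigmaOf hu
  exact Measurable.sub ((measurable_trunc t).comp (h1.mul (h2.sub_const 1)))
    ((hw.measurable_center t).comp h1)

lemma measurable_smallPart (hw : IsBoundaryCascade P w α) (t : ℝ) (u : List ℕ) :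
    Measurable (smallPart P w t u) :=
  (hw.measurable_smallPart_sigmaOf t (Set.mem_univ u) fun _ _ => trivial).mono
    (hw.sigmaOf_row_le _) le_rfl

lemma measurable_bigPart (hw : IsBoundaryCascade P w α) (t : ℝ) (u : List ℕ) :
    Measurable (bigPart P w t u) :=
  ((hw.measurable_node (measurable_trunc t) u).mul ((hw.measurable_total u).sub_const 1)).sub
    (hw.measurable_smallPart t u)

lemma norm_smallPart_le {t : ℝ} (ht : 0 ≤ t) (u : List ℕ) (ω : Ω) :
    ‖smallPart P w t u ω‖ ≤ t + t := by
  refine (norm_sub_le _ _).trans (add_le_add (norm_trunc_le ht _) ?_)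
  refine (norm_integral_le_of_norm_le_const
    (Eventually.of_forall fun _ => norm_trunc_le ht _)).trans ?_
  simp

lemma memLp_smallPart (hw : IsBoundaryCascade P w α) {t : ℝ} (ht : 0 ≤ t) (u : List ℕ) :
    MemLp (smallPart P w t u) 2 P :=
  MemLp.of_bound (hw.measurable_smallPart t u).aestronglyMeasurable (t + t)
    (Eventually.of_forall fun ω => norm_smallPart_le ht u ω)

omit [IsProbabilityMeasure P] in
lemma lintegral_trunc_sq_le (hw : IsBoundaryCascade P w α) {t : ℝ} {z : ℂ} (hz : ‖z‖ ≤ t) :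
    ∫⁻ ω, ‖trunc t (z * (total w [] ω - 1))‖ₑ ^ 2 ∂P ≤
      ENNReal.ofReal ((1 + 2 / (2 - α)) ^ 2 * t ^ (2 - α)) * greenFun α t z *
        ∫⁻ ω, logMomentFun α (total w [] ω - 1) ∂P := by
  have hm : Measurable fun ω => logMomentFun α (total w [] ω - 1) :=
    (measurable_logMomentFun α).comp ((hw.measurable_total []).sub_const 1)
  rw [← lintegral_const_mul _ hm]
  exact lintegral_mono fun ω => enorm_trunc_sq_le hw.lt_two hz _

omit [IsProbabilityMeasure P] in
lemma lintegral_sub_trunc_le (hw : IsBoundaryCascade P w α) {t : ℝ} {z : ℂ} (hz : ‖z‖ ≤ t) :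
    ∫⁻ ω, ‖z * (total w [] ω - 1) - trunc t (z * (total w [] ω - 1))‖ₑ ∂P ≤
      ENNReal.ofReal (t ^ (1 - α)) * greenFun α t z *
        ∫⁻ ω, logMomentFun α (total w [] ω - 1) ∂P := by
  have hm : Measurable fun ω => logMomentFun α (total w [] ω - 1) :=
    (measurable_logMomentFun α).comp ((hw.measurable_total []).sub_const 1)
  rw [← lintegral_const_mul _ hm]
  exact lintegral_mono fun ω => enorm_sub_trunc_le hw.one_lt hz _

lemma integrable_trunc (hw : IsBoundaryCascade P w α) {t : ℝ} (ht : 0 ≤ t) (z : ℂ) :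
    Integrable (fun ω => trunc t (z * (total w [] ω - 1))) P :=
  Integrable.of_bound ((measurable_trunc t).comp
    (((hw.measurable_total []).sub_const 1).const_mul z)).aestronglyMeasurable t
    (Eventually.of_forall fun _ => norm_trunc_le ht _)

/-- The full increment has mean zero, so the mean of its truncation is minus the mean of the part
cut off. -/
lemma enorm_center_le (hw : IsBoundaryCascade P w α) {t : ℝ} {z : ℂ} (hz : ‖z‖ ≤ t) :
    ‖center P w t z‖ₑ ≤ ENNReal.ofReal (t ^ (1 - α)) * greenFun α t z *
        ∫⁻ ω, logMomentFun α (total w [] ω - 1) ∂P := by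
  have ht : 0 ≤ t := (norm_nonneg z).trans hz
  have h1 : Integrable (fun ω => z * (total w [] ω - 1)) P :=
    (hw.integrable_total.sub (integrable_const 1)).const_mul z
  have h2 : ∫ ω, z * (total w [] ω - 1) ∂P = 0 := by
    rw [integral_const_mul, integral_sub hw.integrable_total (integrable_const 1),
      hw.integral_total]
    simp
  have h3 : center P w t z =
      -∫ ω, (z * (total w [] ω - 1) - trunc t (z * (total w [] ω - 1))) ∂P := by
    rw [integral_sub h1 (hw.integrable_trunc ht z), h2, center]
    ring
  rw [h3, enorm_neg]
  exact (enorm_integral_le_lintegral_enorm _).trans (hw.lintegral_sub_trunc_le hz)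

lemma lintegral_smallPart_sq_le (hw : IsBoundaryCascade P w α) {t : ℝ} (ht : 1 ≤ t) (u : List ℕ) :
    ∫⁻ ω, ‖smallPart P w t u ω‖ₑ ^ 2 ∂P ≤
      8 * (ENNReal.ofReal ((1 + 2 / (2 - α)) ^ 2 * t ^ (2 - α)) *
        (∫⁻ ω, greenFun α t (node (trunc t) w u ω) ∂P) *
        ∫⁻ ω, logMomentFun α (total w [] ω - 1) ∂P) := by
  have hτ := measurable_trunc t
  refine (hw.lintegral_total (hw.measurable_node hτ u) (hw.indepFun_node_row hτ u)
    (g := fun z y => ‖trunc t (z * (y - 1)) - center P w t z‖ₑ ^ 2)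
    (((hτ.comp (measurable_fst.mul (measurable_snd.sub_const 1))).sub
      ((hw.measurable_center t).comp measurable_fst)).enorm.pow_const 2)).trans_le ?_
  have hg : Measurable fun ω => greenFun α t (node (trunc t) w u ω) :=
    (measurable_greenFun α t).comp (hw.measurable_node hτ u)
  have hmul : 8 * (ENNReal.ofReal ((1 + 2 / (2 - α)) ^ 2 * t ^ (2 - α)) *
        (∫⁻ ω, greenFun α t (node (trunc t) w u ω) ∂P) *
        ∫⁻ ω, logMomentFun α (total w [] ω - 1) ∂P) =
      ∫⁻ ω, 8 * (ENNReal.ofReal ((1 + 2 / (2 - α)) ^ 2 * t ^ (2 - α)) *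
        greenFun α t (node (trunc t) w u ω) *
        ∫⁻ ω, logMomentFun α (total w [] ω - 1) ∂P) ∂P := by
    rw [lintegral_const_mul _ ((hg.const_mul _).mul_const _), lintegral_mul_const _ (hg.const_mul _)]
    rw [lintegral_const_mul _ hg]
  rw [hmul]
  refine lintegral_mono fun ω => ?_
  have hz := norm_node_trunc_le (w := w) ht u ω
  set z := node (trunc t) w u ω
  have hm : Measurable fun ω => trunc t (z * (total w [] ω - 1)) :=
    hτ.comp (((hw.measurable_total []).sub_const 1).const_mul z)
  calc ∫⁻ ω', ‖trunc t (z * (total w [] ω' - 1)) - center P w t z‖ₑ ^ 2 ∂P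
      ≤ ∫⁻ ω', 4 * (‖trunc t (z * (total w [] ω' - 1))‖ₑ ^ 2 + ‖center P w t z‖ₑ ^ 2) ∂P :=
        lintegral_mono fun ω' => enorm_sub_sq_le _ _
    _ = 4 * (∫⁻ ω', ‖trunc t (z * (total w [] ω' - 1))‖ₑ ^ 2 ∂P + ‖center P w t z‖ₑ ^ 2) := by
        rw [lintegral_const_mul _ ((hm.enorm.pow_const 2).add_const _),
          lintegral_add_left (hm.enorm.pow_const 2)]
        simp
    -- The squared mean is at most the second moment, so centering only doubles the constant.
    _ ≤ 4 * (∫⁻ ω', ‖trunc t (z * (total w [] ω' - 1))‖ₑ ^ 2 ∂P +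
          ∫⁻ ω', ‖trunc t (z * (total w [] ω' - 1))‖ₑ ^ 2 ∂P) := by
        gcongr
        exact enorm_integral_sq_le hm.aestronglyMeasurable
    _ = 8 * ∫⁻ ω', ‖trunc t (z * (total w [] ω' - 1))‖ₑ ^ 2 ∂P := by ring
    _ ≤ _ := by gcongr; exact hw.lintegral_trunc_sq_le hz

lemma lintegral_bigPart_le (hw : IsBoundaryCascade P w α) {t : ℝ} (ht : 1 ≤ t) (u : List ℕ) :
    ∫⁻ ω, ‖bigPart P w t u ω‖ₑ ∂P ≤
      2 * (ENNReal.ofReal (t ^ (1 - α)) *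
        (∫⁻ ω, greenFun α t (node (trunc t) w u ω) ∂P) *
        ∫⁻ ω, logMomentFun α (total w [] ω - 1) ∂P) := by
  have hτ := measurable_trunc t
  have hm0 : Measurable fun p : ℂ × ℂ => p.1 * (p.2 - 1) :=
    measurable_fst.mul (measurable_snd.sub_const 1)
  refine (hw.lintegral_total (hw.measurable_node hτ u) (hw.indepFun_node_row hτ u)
    (g := fun z y => ‖z * (y - 1) - (trunc t (z * (y - 1)) - center P w t z)‖ₑ)
    (hm0.sub ((hτ.comp hm0).sub ((hw.measurable_center t).comp measurable_fst))).enorm).trans_le ?_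
  have hg : Measurable fun ω => greenFun α t (node (trunc t) w u ω) :=
    (measurable_greenFun α t).comp (hw.measurable_node hτ u)
  have hmul : 2 * (ENNReal.ofReal (t ^ (1 - α)) *
        (∫⁻ ω, greenFun α t (node (trunc t) w u ω) ∂P) *
        ∫⁻ ω, logMomentFun α (total w [] ω - 1) ∂P) =
      ∫⁻ ω, 2 * (ENNReal.ofReal (t ^ (1 - α)) * greenFun α t (node (trunc t) w u ω) *
        ∫⁻ ω, logMomentFun α (total w [] ω - 1) ∂P) ∂P := by
    rw [lintegral_const_mul _ ((hg.const_mul _).mul_const _), lintegral_mul_const _ (hg.const_mul _)]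
    rw [lintegral_const_mul _ hg]
  rw [hmul]
  refine lintegral_mono fun ω => ?_
  have hz := norm_node_trunc_le (w := w) ht u ω
  set z := node (trunc t) w u ω
  have hm : Measurable fun ω => z * (total w [] ω - 1) :=
    ((hw.measurable_total []).sub_const 1).const_mul z
  calc ∫⁻ ω', ‖z * (total w [] ω' - 1) - (trunc t (z * (total w [] ω' - 1)) - center P w t z)‖ₑ ∂P
      ≤ ∫⁻ ω', (‖z * (total w [] ω' - 1) - trunc t (z * (total w [] ω' - 1))‖ₑ +
          ‖center P w t z‖ₑ) ∂P := lintegral_mono fun ω' => by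
        rw [← sub_add]
        exact enorm_add_le _ _
    _ = ∫⁻ ω', ‖z * (total w [] ω' - 1) - trunc t (z * (total w [] ω' - 1))‖ₑ ∂P +
          ‖center P w t z‖ₑ := by
        rw [lintegral_add_right _ measurable_const]
        simp
    _ ≤ _ := by
        rw [two_mul]
        exact add_le_add (hw.lintegral_sub_trunc_le hz) (hw.enorm_center_le hz)

/-- `lintegral_gen_trunc` identifies the sum over generation `k` with the `k`-th term of the Green
function for killing level `-log t`. -/
lemma tsum_greenFun_le (hw : IsBoundaryCascade P w α) :
    ∃ C : ℝ≥0∞, C ≠ ∞ ∧ ∀ t : ℝ, 1 ≤ t →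
      ∑' u, ∫⁻ ω, greenFun α t (node (trunc t) w u ω) ∂P ≤ C * ENNReal.ofReal (1 + Real.log t) := by
  have := hw.isProbabilityMeasure_stepLaw hw.lintegral_rpow
  obtain ⟨C, hC, h⟩ := RandomWalk.tsum_iterate_killedOp_le hw.stepLaw_pos
  refine ⟨C, hC, fun t ht => ?_⟩
  rw [tsum_list_eq]
  refine le_trans (le_of_eq ?_) (h (Real.log t) (Real.log_nonneg ht))
  refine tsum_congr fun k => ?_
  exact hw.lintegral_gen_trunc (by linarith [hw.one_lt]) (by linarith)
    (φ := fun y => ENNReal.ofReal ((1 + (Real.log t + y)) ^ 2)⁻¹) (by fun_prop) k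

/-- Since `v` is another word that is not longer than `u`, its small part and the weight of `u`
depend only on rows other than that of `u`. With these frozen, the small part at `u` has mean zero
by centering. -/
lemma integral_smallPart_mul (hw : IsBoundaryCascade P w α) {t : ℝ} (ht : 0 ≤ t) {u v : List ℕ}
    (huv : u ≠ v) (hlen : v.length ≤ u.length) :
    ∫ ω, (starRingEnd ℂ) (smallPart P w t v ω) * smallPart P w t u ω ∂P = 0 := by
  have hτ := measurable_trunc t
  have hU : Measurable[sigmaOf (row w) {u}ᶜ]
      fun ω => (smallPart P w t v ω, node (trunc t) w u ω) := by
    refine Measurable.prodMk (hw.measurable_smallPart_sigmaOf t ?_ fun x hx => ?_)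
      (IsCascade.measurable_node_sigmaOf hτ fun x hx => ?_)
    · simpa using huv.symm
    · simp only [Set.mem_compl_iff, Set.mem_singleton_iff]
      rintro rfl
      omega
    · simp only [Set.mem_compl_iff, Set.mem_singleton_iff]
      rintro rfl
      omega
  have hind := hw.indepFun_row (u := u) (S := {u}ᶜ) (by simp) hU
  have hind' := hind.comp measurable_id measurable_tsum_complex
  refine integral_indepFun_eq_zero (U := fun ω => (smallPart P w t v ω, node (trunc t) w u ω))
    (V := total w u)
    (G := fun p => (starRingEnd ℂ) p.1.1 * (trunc t (p.1.2 * (p.2 - 1)) - center P w t p.1.2))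
    (hU.mono (hw.sigmaOf_row_le _) le_rfl) (hw.measurable_total u) hind' ?_ ?_
  · have h12 : Measurable fun p : (ℂ × ℂ) × ℂ => p.1.2 := measurable_snd.comp measurable_fst
    refine (Complex.continuous_conj.measurable.comp (measurable_fst.comp measurable_fst)).mul
      (Measurable.sub ?_ ((hw.measurable_center t).comp h12))
    exact hτ.comp (h12.mul (measurable_snd.sub_const 1))
  · rintro ⟨a, z⟩
    have hm : Measurable fun y : ℂ => (starRingEnd ℂ) a * (trunc t (z * (y - 1)) - center P w t z) :=
      ((hτ.comp ((measurable_id.sub_const 1).const_mul z)).sub_const _).const_mul _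
    have h1 := ((hw.identDistrib u).comp hm).integral_eq
    refine h1.trans ?_
    change ∫ ω, (starRingEnd ℂ) a * (trunc t (z * (total w [] ω - 1)) - center P w t z) ∂P = 0
    rw [integral_const_mul, integral_sub (hw.integrable_trunc ht z) (integrable_const _), center]
    simp

lemma lintegral_sum_smallPart_sq (hw : IsBoundaryCascade P w α) {t : ℝ} (ht : 0 ≤ t) {ι : Type*}
    {e : ι → List ℕ} (he : e.Injective) (F : Finset ι) :
    ∫⁻ ω, ‖∑ i ∈ F, smallPart P w t (e i) ω‖ₑ ^ 2 ∂P =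
      ∑ i ∈ F, ∫⁻ ω, ‖smallPart P w t (e i) ω‖ₑ ^ 2 ∂P := by
  refine lintegral_sum_sq_eq (fun i => hw.memLp_smallPart ht (e i)) (fun i j hij => ?_) F
  rcases le_total (e i).length (e j).length with h | h
  · exact hw.integral_smallPart_mul ht (he.ne hij.symm) h
  · have h1 := hw.integral_smallPart_mul ht (he.ne hij) h
    have h2 := congrArg (starRingEnd ℂ) h1
    rw [← integral_conj] at h2
    simpa [mul_comm] using h2

end IsBoundaryCascade

end BRW

/-! ### Decomposition of the martingale and its tail. -/

namespace BRW

variable {Ω : Type*} [mΩ : MeasurableSpace Ω] {P : Measure Ω}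
  {w : List ℕ → ℕ → Ω → ℂ} {α : ℝ}

lemma ae_summable_of_tsum_lintegral {ι : Type*} [Countable ι] {f : ι → Ω → ℂ}
    (hf : ∀ i, Measurable (f i)) (h : ∑' i, ∫⁻ ω, ‖f i ω‖ₑ ∂P ≠ ∞) :
    ∀ᵐ ω ∂P, Summable fun i => f i ω := by
  rw [← lintegral_tsum fun i => (hf i).enorm.aemeasurable] at h
  filter_upwards [ae_lt_top (Measurable.tsum fun i => (hf i).enorm) h] with ω hω
  exact (tsum_enorm_ne_top_iff_summable_norm.1 hω.ne).of_norm

lemma measurable_tsum_of_countable {ι : Type*} [Countable ι] {f : ι → Ω → ℂ}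
    (hf : ∀ i, Measurable (f i)) : Measurable fun ω => ∑' i, f i ω :=
  measurable_tsum_complex.comp (measurable_pi_lambda _ hf)

/-- The sum of the weights in generation `n`. -/
noncomputable def genSum (w : List ℕ → ℕ → Ω → ℂ) (n : ℕ) (ω : Ω) : ℂ :=
  ∑' u : Gen n, node id w u ω

/-- The words of length less than `n`. -/
abbrev Below (n : ℕ) : Type := Σ k : Fin n, Gen k

/-- The underlying word. -/
def Below.word {n : ℕ} (p : Below n) : List ℕ := p.2.1

lemma Below.word_injective (n : ℕ) : (Below.word (n := n)).Injective := by
  rintro ⟨k, u, hu⟩ ⟨l, v, hv⟩ h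
  simp only [Below.word] at h
  subst h
  have : k = l := Fin.ext (hu.symm.trans hv)
  subst this
  rfl

lemma Below.tsum_eq {n : ℕ} {f : List ℕ → ℂ} (h : Summable fun p : Below n => f p.word) :
    ∑' p : Below n, f p.word = ∑ k ∈ Finset.range n, ∑' u : Gen k, f u := by
  rw [h.tsum_sigma, tsum_fintype, ← Fin.sum_univ_eq_sum_range (fun k => ∑' u : Gen k, f u)]
  rfl

omit mΩ in
lemma node_trunc_eq {t : ℝ} {ω : Ω} (h : ∀ u j, ‖node (trunc t) w u ω * w u j ω‖ ≤ t)
    (u : List ℕ) : node (trunc t) w u ω = node id w u ω := by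
  induction u with
  | nil => rfl
  | cons j u ih =>
    have h1 := h u j
    simp only [node, id]
    rw [← ih]
    exact if_pos h1

omit mΩ in
lemma norm_node_trunc_le_norm_node (t : ℝ) (u : List ℕ) (ω : Ω) :
    ‖node (trunc t) w u ω‖ ≤ ‖node id w u ω‖ := by
  induction u with
  | nil => rfl
  | cons j u ih =>
    have h : ∀ z, ‖trunc t z‖ ≤ ‖z‖ := fun z => by
      unfold trunc
      split_ifs <;> simp
    refine (h _).trans ?_
    simp only [node, id, norm_mul]
    gcongr

omit mΩ in
lemma genSum_zero (ω : Ω) : genSum w 0 ω = 1 := tsum_gen_zero fun u => node id w u ω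

omit mΩ in
lemma summable_mul_total {n : ℕ} {ω : Ω} (h : Summable fun u : Gen (n + 1) => node id w u ω) :
    Summable (fun u : Gen n => node id w u ω * total w u ω) ∧
      genSum w (n + 1) ω = ∑' u : Gen n, node id w u ω * total w u ω := by
  have h1 : Summable fun p : Gen n × ℕ => node id w p.1 ω * w p.1 p.2 ω :=
    (genSuccEquiv n).summable_iff.2 h
  have h2 : ∀ u : Gen n, ∑' j, node id w u ω * w u j ω = node id w u ω * total w u ω :=
    fun u => tsum_mul_left
  constructor
  · simp_rw [← h2]
    exact h1.prod
  · simp_rw [← h2]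
    rw [← h1.tsum_prod]
    exact ((genSuccEquiv n).tsum_eq fun u : Gen (n + 1) => node id w u ω).symm

omit mΩ in
lemma genSum_succ_sub {n : ℕ} {ω : Ω} (h0 : Summable fun u : Gen n => node id w u ω)
    (h : Summable fun u : Gen (n + 1) => node id w u ω) :
    genSum w (n + 1) ω - genSum w n ω = ∑' u : Gen n, node id w u ω * (total w u ω - 1) := by
  obtain ⟨h1, h2⟩ := summable_mul_total h
  rw [h2, genSum, ← h1.tsum_sub h0]
  exact tsum_congr fun u => by ring

omit mΩ in
lemma genSum_sub_one {ω : Ω} (h : ∀ n, Summable fun u : Gen n => node id w u ω) (n : ℕ) :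
    genSum w n ω - 1 =
      ∑ k ∈ Finset.range n, ∑' u : Gen k, node id w u ω * (total w u ω - 1) := by
  simp_rw [← genSum_succ_sub (h _) (h _)]
  rw [Finset.sum_range_sub (fun k => genSum w k ω), genSum_zero]

namespace IsBoundaryCascade

variable [IsProbabilityMeasure P]

lemma lintegral_gen_enorm_ne_top (hw : IsBoundaryCascade P w α) (n : ℕ) :
    ∑' u : Gen n, ∫⁻ ω, ‖node id w u ω‖ₑ ∂P ≠ ∞ := by
  have := hw.lintegral_gen_id one_pos n
  simp only [ENNReal.rpow_one] at this
  rw [this]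
  exact ENNReal.pow_ne_top hw.lintegral_enorm

lemma ae_summable_gen (hw : IsBoundaryCascade P w α) :
    ∀ᵐ ω ∂P, ∀ n, Summable fun u : Gen n => node id w u ω :=
  ae_all_iff.2 fun n => ae_summable_of_tsum_lintegral
    (fun u => hw.measurable_node measurable_id u) (hw.lintegral_gen_enorm_ne_top n)

lemma lintegral_gen_increment (hw : IsBoundaryCascade P w α) {τ : ℂ → ℂ} (hτ : Measurable τ)
    (hle : ∀ u ω, ‖node τ w u ω‖ ≤ ‖node id w u ω‖) (n : ℕ) :
    ∑' u : Gen n, ∫⁻ ω, ‖node τ w u ω * (total w u ω - 1)‖ₑ ∂P ≠ ∞ := by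
  have h1 : ∫⁻ ω, ‖total w [] ω - 1‖ₑ ∂P ≠ ∞ :=
    (hw.integrable_total.sub (integrable_const (1 : ℂ))).hasFiniteIntegral.ne
  refine ne_top_of_le_ne_top (ENNReal.mul_ne_top (hw.lintegral_gen_enorm_ne_top n) h1) ?_
  rw [← ENNReal.tsum_mul_right]
  refine ENNReal.tsum_le_tsum fun u => ?_
  refine (hw.lintegral_total (hw.measurable_node hτ u) (hw.indepFun_node_row hτ u.1)
    (g := fun z y => ‖z * (y - 1)‖ₑ)
    (measurable_fst.mul (measurable_snd.sub_const 1)).enorm).trans_le ?_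
  rw [← lintegral_mul_const _ (hw.measurable_node measurable_id u.1).enorm]
  refine lintegral_mono fun ω => ?_
  simp_rw [enorm_mul]
  rw [lintegral_const_mul _ ((hw.measurable_total []).sub_const 1).enorm]
  gcongr
  rw [← ofReal_norm, ← ofReal_norm]
  exact ENNReal.ofReal_le_ofReal (hle _ _)

lemma lintegral_below_increment (hw : IsBoundaryCascade P w α) (t : ℝ) (n : ℕ) :
    ∑' p : Below n, ∫⁻ ω, ‖node (trunc t) w p.word ω * (total w p.word ω - 1)‖ₑ ∂P ≠ ∞ := by
  rw [ENNReal.tsum_sigma', tsum_fintype]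
  refine (ENNReal.sum_lt_top.2 fun k _ => ?_).ne
  exact (hw.lintegral_gen_increment (measurable_trunc t)
    (fun u ω => norm_node_trunc_le_norm_node t u ω) k).lt_top

/-- The tail estimate for the martingale. -/
theorem measure_genSum_sub_one_le (hw : IsBoundaryCascade P w α) :
    ∃ C : ℝ≥0∞, C ≠ ∞ ∧ ∀ t : ℝ, 1 ≤ t → ∀ n,
      P {ω | 2 * t < ‖genSum w n ω - 1‖} ≤ C * ENNReal.ofReal (t ^ (-α) * (1 + Real.log t)) := by
  obtain ⟨C, hC, hC'⟩ := hw.tsum_greenFun_le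
  set A := ∫⁻ ω, logMomentFun α (total w [] ω - 1) ∂P with hA
  have hA' : A ≠ ∞ := hw.lintegral_logMoment
  set K : ℝ := (1 + 2 / (2 - α)) ^ 2 with hK
  refine ⟨1 + (8 * (ENNReal.ofReal K * C * A) + 2 * (C * A)), by finiteness, fun t ht n => ?_⟩
  have ht0 : 0 < t := by linarith
  have hlog := Real.log_nonneg ht
  set q := ENNReal.ofReal (t ^ (-α) * (1 + Real.log t)) with hq
  have hTm := fun p : Below n => hw.measurable_smallPart t p.word
  have hRm := fun p : Below n => hw.measurable_bigPart t p.word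
  have hGsum : ∑' p : Below n, ∫⁻ ω, greenFun α t (node (trunc t) w p.word ω) ∂P ≤
      C * ENNReal.ofReal (1 + Real.log t) :=
    (ENNReal.tsum_comp_le_tsum_of_injective (Below.word_injective n) fun u =>
      ∫⁻ ω, greenFun α t (node (trunc t) w u ω) ∂P).trans (hC' t ht)
  have hRsum : ∑' p : Below n, ∫⁻ ω, ‖bigPart P w t p.word ω‖ₑ ∂P ≤
      2 * (ENNReal.ofReal (t ^ (1 - α)) * (C * ENNReal.ofReal (1 + Real.log t)) * A) := by
    refine (ENNReal.tsum_le_tsum fun p => hw.lintegral_bigPart_le ht _).trans ?_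
    rw [ENNReal.tsum_mul_left, ENNReal.tsum_mul_right, ENNReal.tsum_mul_left]
    gcongr
  have hTsum : ∑' p : Below n, ∫⁻ ω, ‖smallPart P w t p.word ω‖ₑ ^ 2 ∂P ≤
      8 * (ENNReal.ofReal (K * t ^ (2 - α)) * (C * ENNReal.ofReal (1 + Real.log t)) * A) := by
    refine (ENNReal.tsum_le_tsum fun p => hw.lintegral_smallPart_sq_le ht _).trans ?_
    rw [ENNReal.tsum_mul_left, ENNReal.tsum_mul_right, ENNReal.tsum_mul_left]
    gcongr
  have hDs := ae_summable_of_tsum_lintegral (fun p : Below n =>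
    (hw.measurable_node (measurable_trunc t) p.word).mul
      ((hw.measurable_total p.word).sub_const 1)) (hw.lintegral_below_increment t n)
  have hRs := ae_summable_of_tsum_lintegral hRm (ne_top_of_le_ne_top (by finiteness) hRsum)
  -- The `L²` bounds do not give absolute summability of the small parts; they are summable as
  -- differences of two summable families.
  have hTs : ∀ᵐ ω ∂P, Summable fun p : Below n => smallPart P w t p.word ω := by
    filter_upwards [hDs, hRs] with ω h1 h2
    refine (h1.sub h2).congr fun p => ?_
    simp [bigPart]
  have hT2 : ∫⁻ ω, ‖∑' p : Below n, smallPart P w t p.word ω‖ₑ ^ 2 ∂P ≤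
      8 * (ENNReal.ofReal (K * t ^ (2 - α)) * (C * ENNReal.ofReal (1 + Real.log t)) * A) := by
    refine lintegral_tsum_sq_le hTm hTs fun F => ?_
    rw [hw.lintegral_sum_smallPart_sq ht0.le (Below.word_injective n)]
    exact (ENNReal.sum_le_tsum F).trans hTsum
  have hR1 : ∫⁻ ω, ‖∑' p : Below n, bigPart P w t p.word ω‖ₑ ∂P ≤
      2 * (ENNReal.ofReal (t ^ (1 - α)) * (C * ENNReal.ofReal (1 + Real.log t)) * A) := by
    refine le_trans ?_ hRsum
    rw [← lintegral_tsum fun p => (hRm p).enorm.aemeasurable]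
    exact lintegral_mono fun ω => enorm_tsum_le_tsum_enorm
  have hTmeas := measurable_tsum_of_countable hTm
  have hRmeas := measurable_tsum_of_countable hRm
  set E₁ : Set Ω := {ω | ∃ u j, t < ‖node (trunc t) w u ω * w u j ω‖} with hE₁
  set E₂ : Set Ω := {ω | ENNReal.ofReal (t ^ 2) ≤ ‖∑' p : Below n, smallPart P w t p.word ω‖ₑ ^ 2}
  set E₃ : Set Ω := {ω | ENNReal.ofReal t ≤ ‖∑' p : Below n, bigPart P w t p.word ω‖ₑ}
  -- Off `E₁` truncation never acts, so `Z_n - 1` is the sum of the small and big parts; off `E₂`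
  -- and `E₃` each sum is smaller than `t`.
  have hsub : {ω | 2 * t < ‖genSum w n ω - 1‖} ≤ᵐ[P] (E₁ ∪ (E₂ ∪ E₃) : Set Ω) := by
    filter_upwards [hDs, hRs, hTs, hw.ae_summable_gen] with ω h1 h2 h3 h4 hω
    by_contra hnot
    have hnot1 : ω ∉ E₁ := fun h => hnot (Or.inl h)
    have hnot2 : ω ∉ E₂ := fun h => hnot (Or.inr (Or.inl h))
    have hnot3 : ω ∉ E₃ := fun h => hnot (Or.inr (Or.inr h))
    have hgood : ∀ u j, ‖node (trunc t) w u ω * w u j ω‖ ≤ t := by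
      intro u j
      by_contra! h
      exact hnot1 ⟨u, j, h⟩
    have hsum : genSum w n ω - 1 = (∑' p : Below n, smallPart P w t p.word ω) +
        ∑' p : Below n, bigPart P w t p.word ω := by
      rw [genSum_sub_one h4, ← h3.tsum_add h2]
      simp_rw [← node_trunc_eq hgood]
      rw [← Below.tsum_eq (f := fun u => node (trunc t) w u ω * (total w u ω - 1)) h1]
      exact tsum_congr fun p => by simp [bigPart]
    have h5 : ‖∑' p : Below n, smallPart P w t p.word ω‖ < t := by
      have : ‖∑' p : Below n, smallPart P w t p.word ω‖ₑ ^ 2 < ENNReal.ofReal (t ^ 2) :=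
        not_le.1 hnot2
      rw [← ofReal_norm, ← ENNReal.ofReal_pow (norm_nonneg _),
        ENNReal.ofReal_lt_ofReal_iff (by positivity)] at this
      exact lt_of_pow_lt_pow_left₀ 2 ht0.le this
    have h6 : ‖∑' p : Below n, bigPart P w t p.word ω‖ < t := by
      have : ‖∑' p : Below n, bigPart P w t p.word ω‖ₑ < ENNReal.ofReal t := not_le.1 hnot3
      rwa [← ofReal_norm, ENNReal.ofReal_lt_ofReal_iff ht0] at this
    have h7 : 2 * t < ‖genSum w n ω - 1‖ := hω
    rw [hsum] at h7
    have := norm_add_le (∑' p : Below n, smallPart P w t p.word ω)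
      (∑' p : Below n, bigPart P w t p.word ω)
    linarith
  have hP1 : P E₁ ≤ 1 * q := by
    refine (hw.measure_exceed_le (by linarith [hw.one_lt]) hw.lintegral_rpow ht0).trans ?_
    rw [one_mul]
    apply ENNReal.ofReal_le_ofReal
    exact le_mul_of_one_le_right (by positivity) (by linarith)
  have hP2 : P E₂ ≤ 8 * (ENNReal.ofReal K * C * A) * q := by
    refine (meas_ge_le_lintegral_div (hTmeas.enorm.pow_const 2).aemeasurable
      (by simp; positivity) ENNReal.ofReal_ne_top).trans ?_
    refine ENNReal.div_le_of_le_mul (hT2.trans (le_of_eq ?_))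
    -- Dividing the second moment by `t²` leaves the order `t^{-α} (1 + log t)` common to all three
    -- events.
    have : t ^ (2 - α) = t ^ (-α) * t ^ 2 := by
      rw [← Real.rpow_natCast, ← Real.rpow_add ht0]
      congr 1
      push_cast
      ring
    rw [this, hq, ENNReal.ofReal_mul (by positivity), ENNReal.ofReal_mul (by positivity),
      ENNReal.ofReal_mul (by positivity)]
    ring
  have hP3 : P E₃ ≤ 2 * (C * A) * q := by
    refine (meas_ge_le_lintegral_div hRmeas.enorm.aemeasurable
      (by simpa using ht0) ENNReal.ofReal_ne_top).trans ?_
    refine ENNReal.div_le_of_le_mul (hR1.trans (le_of_eq ?_))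
    have : t ^ (1 - α) = t ^ (-α) * t := by
      nth_rw 3 [← Real.rpow_one t]
      rw [← Real.rpow_add ht0]
      congr 1
      ring
    rw [this, hq, ENNReal.ofReal_mul (by positivity), ENNReal.ofReal_mul (by positivity)]
    ring
  calc P {ω | 2 * t < ‖genSum w n ω - 1‖} ≤ P (E₁ ∪ (E₂ ∪ E₃)) := measure_mono_ae hsub
    _ ≤ P E₁ + (P E₂ + P E₃) :=
        (measure_union_le _ _).trans (add_le_add le_rfl (measure_union_le _ _))
    _ ≤ 1 * q + (8 * (ENNReal.ofReal K * C * A) * q + 2 * (C * A) * q) :=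
        add_le_add hP1 (add_le_add hP2 hP3)
    _ = _ := by ring

end IsBoundaryCascade

end BRW

/-! ### From the tail bound to moments, convergence and non-degeneracy. -/

namespace BRW

variable {Ω : Type*} [mΩ : MeasurableSpace Ω] {P : Measure Ω} [IsProbabilityMeasure P]
  {w : List ℕ → ℕ → Ω → ℂ} {α : ℝ}

/-- Dyadic layers: if `‖X‖ ≥ 4`, some `k` has `4 · 2^k ≤ ‖X‖ < 8 · 2^k`, which puts the point in the
event of the tail bound with `t = 2^k`. -/
lemma lintegral_rpow_le_of_tail {X : Ω → ℂ} (hX : Measurable X) {C : ℝ≥0∞}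
    (h : ∀ t : ℝ, 1 ≤ t → P {ω | 2 * t < ‖X ω‖} ≤ C * ENNReal.ofReal (t ^ (-α) * (1 + Real.log t)))
    {p : ℝ} (hp : 0 < p) :
    ∫⁻ ω, ‖X ω‖ₑ ^ p ∂P ≤ ENNReal.ofReal (4 ^ p) +
      C * ∑' k : ℕ, ENNReal.ofReal (8 ^ p * ((2 ^ (p - α)) ^ k * (1 + k))) := by
  set E : ℕ → Set Ω := fun k => {ω | 2 * 2 ^ k < ‖X ω‖} with hE
  have hEm : ∀ k, MeasurableSet (E k) := fun k => measurableSet_lt measurable_const hX.norm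
  have hpt : ∀ ω, ‖X ω‖ₑ ^ p ≤ ENNReal.ofReal (4 ^ p) +
      ∑' k : ℕ, (E k).indicator (fun _ => ENNReal.ofReal ((8 * 2 ^ k) ^ p)) ω := by
    intro ω
    rw [← ofReal_norm, ENNReal.ofReal_rpow_of_nonneg (norm_nonneg _) hp.le]
    by_cases h4 : ‖X ω‖ < 4
    · refine le_trans ?_ le_self_add
      gcongr
    · refine le_trans ?_ le_add_self
      obtain ⟨k, hk1, hk2⟩ := exists_nat_pow_near (x := ‖X ω‖ / 4) (y := 2)
        (by rw [one_le_div (by norm_num)]; exact not_lt.1 h4) (by norm_num)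
      have hmem : ω ∈ E k := by
        simp only [hE, Set.mem_ofPred_eq]
        have : (0 : ℝ) < 2 ^ k := by positivity
        linarith
      refine le_trans ?_ (ENNReal.le_tsum k)
      rw [Set.indicator_of_mem hmem]
      gcongr
      rw [pow_succ] at hk2
      linarith
  refine (lintegral_mono hpt).trans ?_
  rw [lintegral_add_left measurable_const, lintegral_const, measure_univ, mul_one,
    lintegral_tsum fun k => (measurable_const.indicator (hEm k)).aemeasurable,
    ← ENNReal.tsum_mul_left]
  gcongr with k
  rw [lintegral_indicator_const (hEm k)]
  have h1 := h (2 ^ k) (one_le_pow₀ (by norm_num))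
  refine (mul_le_mul_right h1 _).trans ?_
  rw [mul_left_comm, ← ENNReal.ofReal_mul (by positivity)]
  refine mul_le_mul_right (ENNReal.ofReal_le_ofReal ?_) C
  have h2 : ((2 : ℝ) ^ k) ^ p * ((2 : ℝ) ^ k) ^ (-α) = (2 ^ (p - α)) ^ k := by
    rw [← Real.rpow_add (by positivity), ← Real.rpow_natCast, ← Real.rpow_mul (by norm_num),
      ← Real.rpow_natCast, ← Real.rpow_mul (by norm_num)]
    congr 1
    ring
  have h3 : Real.log (2 ^ k) ≤ k := by
    rw [Real.log_pow]
    have : Real.log 2 ≤ 1 := by linarith [Real.log_two_lt_d9]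
    nlinarith [(Nat.cast_nonneg k : (0 : ℝ) ≤ k)]
  rw [Real.mul_rpow (by norm_num) (by positivity), ← h2]
  calc (8 : ℝ) ^ p * (2 ^ k) ^ p * ((2 ^ k) ^ (-α) * (1 + Real.log (2 ^ k)))
      = 8 ^ p * ((2 ^ k) ^ p * (2 ^ k) ^ (-α) * (1 + Real.log (2 ^ k))) := by ring
    _ ≤ _ := by gcongr

lemma tsum_dyadic_ne_top {p : ℝ} (hp : p < α) :
    ∑' k : ℕ, ENNReal.ofReal (8 ^ p * ((2 ^ (p - α)) ^ k * (1 + k))) ≠ ∞ := by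
  have hr : (2 : ℝ) ^ (p - α) < 1 := Real.rpow_lt_one_of_one_lt_of_neg (by norm_num) (by linarith)
  have hr0 : (0 : ℝ) < 2 ^ (p - α) := by positivity
  have hn : ‖(2 : ℝ) ^ (p - α)‖ < 1 := by rwa [Real.norm_of_nonneg hr0.le]
  have h1 := summable_pow_mul_geometric_of_norm_lt_one 1 hn
  have h0 := summable_geometric_of_norm_lt_one hn
  refine (((h0.add h1).congr fun k => ?_).mul_left ((8 : ℝ) ^ p)).tsum_ofReal_ne_top
  simp
  ring

/-- Cut at a level `M`: the part above contributes at most `M^{p-q} B`, small uniformly in `n`, and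
the bounded part tends to zero by dominated convergence. -/
lemma tendsto_lintegral_rpow_of_bdd {X : ℕ → Ω → ℂ} (hX : ∀ n, Measurable (X n))
    (h0 : ∀ᵐ ω ∂P, Tendsto (fun n => X n ω) atTop (𝓝 0)) {p q : ℝ} (hp : 0 < p) (hpq : p < q)
    {B : ℝ≥0∞} (hB : B ≠ ∞) (h : ∀ n, ∫⁻ ω, ‖X n ω‖ₑ ^ q ∂P ≤ B) :
    Tendsto (fun n => ∫⁻ ω, ‖X n ω‖ₑ ^ p ∂P) atTop (𝓝 0) := by
  rw [ENNReal.tendsto_nhds_zero]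
  intro ε hε
  have hε2 : 0 < ε / 2 := ENNReal.half_pos hε.ne'
  have hM : ∃ M : ℝ, 0 < M ∧ ENNReal.ofReal (M ^ (p - q)) * B ≤ ε / 2 := by
    have h1 : Tendsto (fun M : ℝ => ENNReal.ofReal (M ^ (p - q)) * B) atTop (𝓝 0) := by
      have h2 : Tendsto (fun M : ℝ => M ^ (-(q - p))) atTop (𝓝 0) :=
        tendsto_rpow_neg_atTop (by linarith)
      have h3 := ENNReal.Tendsto.mul_const (b := B) (ENNReal.tendsto_ofReal h2) (Or.inr hB)
      simpa [neg_sub] using h3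
    obtain ⟨M, hM1, hM2⟩ := ((eventually_gt_atTop 0).and
      (ENNReal.tendsto_nhds_zero.1 h1 _ hε2)).exists
    exact ⟨M, hM1, hM2⟩
  obtain ⟨M, hM0, hM⟩ := hM
  have hpt : ∀ x : ℂ, ‖x‖ₑ ^ p ≤ min ‖x‖ₑ (ENNReal.ofReal M) ^ p +
      ENNReal.ofReal (M ^ (p - q)) * ‖x‖ₑ ^ q := by
    intro x
    rcases le_total ‖x‖ M with hx | hx
    · refine le_trans ?_ le_self_add
      rw [min_eq_left]
      rw [← ofReal_norm]
      exact ENNReal.ofReal_le_ofReal hx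
    · refine le_trans ?_ le_add_self
      have hx0 : 0 < ‖x‖ := by linarith
      rw [← ofReal_norm, ENNReal.ofReal_rpow_of_pos hx0, ENNReal.ofReal_rpow_of_pos hx0,
        ← ENNReal.ofReal_mul (by positivity)]
      apply ENNReal.ofReal_le_ofReal
      calc ‖x‖ ^ p = ‖x‖ ^ (p - q) * ‖x‖ ^ q := by
            rw [← Real.rpow_add hx0, sub_add_cancel]
        _ ≤ M ^ (p - q) * ‖x‖ ^ q := by
            gcongr ?_ * _
            exact Real.rpow_le_rpow_of_nonpos hM0 hx (by linarith)
  have hdom : Tendsto (fun n => ∫⁻ ω, min ‖X n ω‖ₑ (ENNReal.ofReal M) ^ p ∂P) atTop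
      (𝓝 (∫⁻ _, 0 ∂P)) := by
    refine tendsto_lintegral_of_dominated_convergence (fun _ => ENNReal.ofReal M ^ p)
      (fun n => ((hX n).enorm.min measurable_const).pow_const p)
      (fun n => Eventually.of_forall fun ω => ?_) ?_ ?_
    · exact ENNReal.rpow_le_rpow (min_le_right _ _) hp.le
    · simpa using ENNReal.rpow_ne_top_of_nonneg hp.le ENNReal.ofReal_ne_top
    · filter_upwards [h0] with ω hω
      have h1 : Tendsto (fun n => min ‖X n ω‖ₑ (ENNReal.ofReal M)) atTop (𝓝 0) := by
        have := hω.enorm.min (tendsto_const_nhds (x := ENNReal.ofReal M))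
        simpa using this
      have h2 := (ENNReal.continuous_rpow_const (y := p)).tendsto 0
      rw [ENNReal.zero_rpow_of_pos hp] at h2
      exact h2.comp h1
  rw [lintegral_zero, ENNReal.tendsto_nhds_zero] at hdom
  filter_upwards [hdom _ hε2] with n hn
  calc ∫⁻ ω, ‖X n ω‖ₑ ^ p ∂P ≤ ∫⁻ ω, (min ‖X n ω‖ₑ (ENNReal.ofReal M) ^ p +
        ENNReal.ofReal (M ^ (p - q)) * ‖X n ω‖ₑ ^ q) ∂P := lintegral_mono fun ω => hpt _
    _ = ∫⁻ ω, min ‖X n ω‖ₑ (ENNReal.ofReal M) ^ p ∂P +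
        ENNReal.ofReal (M ^ (p - q)) * ∫⁻ ω, ‖X n ω‖ₑ ^ q ∂P := by
      rw [lintegral_add_left (((hX n).enorm.min measurable_const).pow_const p),
        lintegral_const_mul _ ((hX n).enorm.pow_const q)]
    _ ≤ ε / 2 + ENNReal.ofReal (M ^ (p - q)) * B := by gcongr; exact h n
    _ ≤ ε / 2 + ε / 2 := by gcongr
    _ = ε := ENNReal.add_halves ε

namespace IsBoundaryCascade

omit [IsProbabilityMeasure P] in
lemma measurable_genSum (hw : IsBoundaryCascade P w α) (n : ℕ) : Measurable (genSum w n) :=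
  measurable_tsum_of_countable fun u : Gen n => hw.measurable_node measurable_id u

lemma integrable_genSum (hw : IsBoundaryCascade P w α) (n : ℕ) :
    Integrable (genSum w n) P := by
  refine ⟨(hw.measurable_genSum n).aestronglyMeasurable, ?_⟩
  refine lt_of_le_of_lt (lintegral_mono fun ω => enorm_tsum_le_tsum_enorm) ?_
  rw [lintegral_tsum fun u : Gen n => (hw.measurable_node measurable_id u).enorm.aemeasurable]
  exact (hw.lintegral_gen_enorm_ne_top n).lt_top

/-- The moments of the martingale of order less than `α` are bounded. -/
lemma lintegral_genSum_rpow_le (hw : IsBoundaryCascade P w α) {p : ℝ} (hp : 0 < p) (hpα : p < α) :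
    ∃ B : ℝ≥0∞, B ≠ ∞ ∧ ∀ n, ∫⁻ ω, ‖genSum w n ω - 1‖ₑ ^ p ∂P ≤ B := by
  obtain ⟨C, hC, h⟩ := hw.measure_genSum_sub_one_le
  refine ⟨_, ?_, fun n => lintegral_rpow_le_of_tail ((hw.measurable_genSum n).sub_const 1)
    (fun t ht => h t ht n) hp⟩
  exact ENNReal.add_ne_top.2 ⟨ENNReal.ofReal_ne_top, ENNReal.mul_ne_top hC (tsum_dyadic_ne_top hpα)⟩

/-- The σ-algebras generated by the first generations. -/
noncomputable def filtration (hw : IsBoundaryCascade P w α) : Filtration ℕ mΩ where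
  seq n := sigmaOf (row w) {v | v.length < n}
  mono' _ _ hmn := sigmaOf_mono fun _ hv => lt_of_lt_of_le hv hmn
  le' _ := hw.sigmaOf_row_le _

omit [IsProbabilityMeasure P] in
lemma measurable_genSum_filtration (hw : IsBoundaryCascade P w α) (n : ℕ) :
    Measurable[hw.filtration n] (genSum w n) := by
  refine measurable_tsum_complex.comp (@measurable_pi_lambda _ _ _ (hw.filtration n) _ _ fun u => ?_)
  refine IsCascade.measurable_node_sigmaOf measurable_id fun v hv => ?_
  rw [u.2] at hv
  exact hv

/-- For `u` of length `n`, the event `A` and the weight of `u` depend only on rows of shorter words,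
while the total below `u` is independent of them with mean 1. -/
lemma setIntegral_genSum_succ (hw : IsBoundaryCascade P w α) (n : ℕ) {A : Set Ω}
    (hA : MeasurableSet[hw.filtration n] A) :
    ∫ ω in A, genSum w n ω ∂P = ∫ ω in A, genSum w (n + 1) ω ∂P := by
  have hA' : MeasurableSet A := hw.filtration.le n A hA
  symm
  rw [← sub_eq_zero, ← integral_sub (hw.integrable_genSum _).integrableOn
    (hw.integrable_genSum _).integrableOn]
  have hfm : ∀ u : Gen n, Measurable fun ω => node id w u ω * (total w u ω - 1) := fun u =>
    (hw.measurable_node measurable_id u).mul ((hw.measurable_total u).sub_const 1)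
  have hae : ∀ᵐ ω ∂P.restrict A, genSum w (n + 1) ω - genSum w n ω =
      ∑' u : Gen n, node id w u ω * (total w u ω - 1) := by
    refine ae_restrict_of_ae ?_
    filter_upwards [hw.ae_summable_gen] with ω hω
    exact genSum_succ_sub (hω n) (hω (n + 1))
  rw [integral_congr_ae hae, integral_tsum fun u => (hfm u).aestronglyMeasurable]
  · refine (tsum_congr fun u => ?_).trans tsum_zero
    have hU : Measurable[sigmaOf (row w) {v | v.length < n}] (A.indicator (node id w u.1)) :=
      Measurable.indicator (IsCascade.measurable_node_sigmaOf measurable_id fun v hv => by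
        rw [u.2] at hv
        exact hv) hA
    have hind := (hw.indepFun_row (u := u.1) (S := {v | v.length < n})
      (by simp [u.2]) hU).comp measurable_id measurable_tsum_complex
    have hzero := integral_indepFun_eq_zero (V := total w u.1)
      (hU.mono (hw.sigmaOf_row_le _) le_rfl) (hw.measurable_total u) hind
      (G := fun p => p.1 * (p.2 - 1)) (measurable_fst.mul (measurable_snd.sub_const 1)) (fun c => by
        have hm : Measurable fun y : ℂ => c * (y - 1) := (measurable_id.sub_const 1).const_mul c
        refine (((hw.identDistrib u).comp hm).integral_eq).trans ?_
        change ∫ ω, c * (total w [] ω - 1) ∂P = 0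
        rw [integral_const_mul, integral_sub hw.integrable_total (integrable_const 1),
          hw.integral_total]
        simp)
    rw [← integral_indicator hA', ← hzero]
    refine integral_congr_ae (Eventually.of_forall fun ω => ?_)
    by_cases hω : ω ∈ A <;> simp [hω]
  · refine ne_top_of_le_ne_top (hw.lintegral_gen_increment measurable_id (fun _ _ => le_rfl) n) ?_
    exact ENNReal.tsum_le_tsum fun u => lintegral_mono' Measure.restrict_le_self le_rfl

lemma martingale_genSum (hw : IsBoundaryCascade P w α) :
    Martingale (genSum w) hw.filtration P :=
  martingale_of_setIntegral_eq_succ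
    (fun n => (hw.measurable_genSum_filtration n).stronglyMeasurable) hw.integrable_genSum
    fun n _ hA => hw.setIntegral_genSum_succ n hA

/-- Reduces the complex martingale to real ones, namely its real and imaginary parts. The `L¹` bound
is the moment bound of order `1 < α`. -/
lemma ae_exists_tendsto_of_linear (hw : IsBoundaryCascade P w α) (L : ℂ →L[ℝ] ℝ) :
    ∀ᵐ ω ∂P, ∃ c, Tendsto (fun n => L (genSum w n ω)) atTop (𝓝 c) := by
  have hmart : Martingale (fun n ω => L (genSum w n ω)) hw.filtration P := by
    refine martingale_of_setIntegral_eq_succ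
      (fun n => (L.measurable.comp (hw.measurable_genSum_filtration n)).stronglyMeasurable)
      (fun n => L.integrable_comp (hw.integrable_genSum n)) fun n A hA => ?_
    rw [L.integral_comp_comm (hw.integrable_genSum n).integrableOn,
      L.integral_comp_comm (hw.integrable_genSum (n + 1)).integrableOn,
      hw.setIntegral_genSum_succ n hA]
  obtain ⟨B, hB, hB'⟩ := hw.lintegral_genSum_rpow_le one_pos hw.one_lt
  have hB1 : ‖L‖ₑ * (B + 1) ≠ ∞ := by finiteness
  refine hmart.submartingale.exists_ae_tendsto_of_bdd (R := (‖L‖ₑ * (B + 1)).toNNReal) fun n => ?_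
  rw [ENNReal.coe_toNNReal hB1, eLpNorm_one_eq_lintegral_enorm]
  calc ∫⁻ ω, ‖L (genSum w n ω)‖ₑ ∂P ≤ ∫⁻ ω, ‖L‖ₑ * (‖genSum w n ω - 1‖ₑ ^ (1 : ℝ) + 1) ∂P := by
        refine lintegral_mono fun ω => (L.le_opENorm _).trans ?_
        gcongr
        rw [ENNReal.rpow_one]
        calc ‖genSum w n ω‖ₑ = ‖(genSum w n ω - 1) + 1‖ₑ := by rw [sub_add_cancel]
          _ ≤ ‖genSum w n ω - 1‖ₑ + ‖(1 : ℂ)‖ₑ := enorm_add_le _ _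
          _ = _ := by simp
    _ = ‖L‖ₑ * (∫⁻ ω, ‖genSum w n ω - 1‖ₑ ^ (1 : ℝ) ∂P + 1) := by
        have hm : Measurable fun ω => ‖genSum w n ω - 1‖ₑ ^ (1 : ℝ) :=
          ((hw.measurable_genSum n).sub_const 1).enorm.pow_const 1
        rw [lintegral_const_mul _ (hm.add_const 1), lintegral_add_left hm]
        simp
    _ ≤ ‖L‖ₑ * (B + 1) := by gcongr; exact hB' n

lemma ae_exists_tendsto (hw : IsBoundaryCascade P w α) :
    ∀ᵐ ω ∂P, ∃ c, Tendsto (fun n => genSum w n ω) atTop (𝓝 c) := by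
  filter_upwards [hw.ae_exists_tendsto_of_linear Complex.reCLM,
    hw.ae_exists_tendsto_of_linear Complex.imCLM] with ω ⟨a, ha⟩ ⟨b, hb⟩
  refine ⟨a + b * Complex.I, ?_⟩
  have h1 := (Complex.continuous_ofReal.tendsto a).comp ha
  have h2 := ((Complex.continuous_ofReal.tendsto b).comp hb).mul_const Complex.I
  refine (h1.add h2).congr fun n => ?_
  simp

/-- Convergence of the martingale of a cascade at the boundary. -/
theorem exists_limit (hw : IsBoundaryCascade P w α) (hnt : ¬ ∀ᵐ ω ∂P, genSum w 1 ω = 1) :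
    ∃ Z : Ω → ℂ,
      (∀ᵐ ω ∂P, Tendsto (fun n => genSum w n ω) atTop (𝓝 (Z ω))) ∧
      (∀ p : ℝ, 0 < p → p < α →
        (∀ n, MemLp (genSum w n) (ENNReal.ofReal p) P) ∧
        MemLp Z (ENNReal.ofReal p) P ∧
        Tendsto (fun n => eLpNorm (fun ω => genSum w n ω - Z ω) (ENNReal.ofReal p) P)
          atTop (𝓝 0)) ∧
      ¬ ∃ c : ℂ, ∀ᵐ ω ∂P, Z ω = c := by
  obtain ⟨Z, hZm, hZ⟩ := measurable_limit_of_tendsto_metrizable_ae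
    (fun n => (hw.measurable_genSum n).aemeasurable) hw.ae_exists_tendsto
  have hFatou : ∀ q : ℝ, 0 < q → q < α → ∃ B : ℝ≥0∞, B ≠ ∞ ∧
      (∀ n, ∫⁻ ω, ‖genSum w n ω - 1‖ₑ ^ q ∂P ≤ B) ∧ ∫⁻ ω, ‖Z ω - 1‖ₑ ^ q ∂P ≤ B := by
    intro q hq hqα
    obtain ⟨B, hB, hB'⟩ := hw.lintegral_genSum_rpow_le hq hqα
    refine ⟨B, hB, hB', ?_⟩
    calc ∫⁻ ω, ‖Z ω - 1‖ₑ ^ q ∂P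
        = ∫⁻ ω, liminf (fun n => ‖genSum w n ω - 1‖ₑ ^ q) atTop ∂P := by
          refine lintegral_congr_ae ?_
          filter_upwards [hZ] with ω hω
          refine (Tendsto.liminf_eq ?_).symm
          exact ((ENNReal.continuous_rpow_const (y := q)).tendsto _).comp (hω.sub_const 1).enorm
      _ ≤ liminf (fun n => ∫⁻ ω, ‖genSum w n ω - 1‖ₑ ^ q ∂P) atTop :=
          lintegral_liminf_le fun n => ((hw.measurable_genSum n).sub_const 1).enorm.pow_const q
      _ ≤ B := by
          refine liminf_le_of_le (by isBoundedDefault) fun b hb => ?_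
          obtain ⟨n, hn⟩ := hb.exists
          exact hn.trans (hB' n)
  have hmem : ∀ p : ℝ, 0 < p → ∀ X : Ω → ℂ, Measurable X →
      ∫⁻ ω, ‖X ω - 1‖ₑ ^ p ∂P ≠ ∞ → MemLp X (ENNReal.ofReal p) P := by
    intro p hp X hX hfin
    have h1 : MemLp (fun ω => X ω - 1) (ENNReal.ofReal p) P := by
      refine ⟨(hX.sub_const 1).aestronglyMeasurable, ?_⟩
      rw [eLpNorm_lt_top_iff_lintegral_rpow_enorm_lt_top (by simpa using hp) ENNReal.ofReal_ne_top,
        ENNReal.toReal_ofReal hp.le]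
      exact hfin.lt_top
    have h2 := h1.add (memLp_const (1 : ℂ))
    refine h2.congr_norm hX.aestronglyMeasurable (Eventually.of_forall fun ω => ?_)
    simp
  have hconv : ∀ p : ℝ, 0 < p → p < α →
      Tendsto (fun n => ∫⁻ ω, ‖genSum w n ω - Z ω‖ₑ ^ p ∂P) atTop (𝓝 0) := by
    intro p hp hpα
    -- Beyond `p < q < α`, also `q > 1`, for the convexity bound on the `q`-th power of a sum.
    obtain ⟨q, hq1, hq2⟩ := exists_between (max_lt hpα hw.one_lt)
    have hpq : p < q := lt_of_le_of_lt (le_max_left _ _) hq1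
    have h1q : 1 < q := lt_of_le_of_lt (le_max_right _ _) hq1
    obtain ⟨B, hB, hB1, hB2⟩ := hFatou q (by linarith) hq2
    refine tendsto_lintegral_rpow_of_bdd (fun n => (hw.measurable_genSum n).sub hZm) ?_ hp hpq
      (B := 2 ^ (q - 1) * (B + B)) ?_ fun n => ?_
    · filter_upwards [hZ] with ω hω
      simpa using hω.sub_const (Z ω)
    · exact ENNReal.mul_ne_top (ENNReal.rpow_ne_top_of_nonneg (by linarith) (by simp))
        (ENNReal.add_ne_top.2 ⟨hB, hB⟩)
    · have hm1 : Measurable fun ω => ‖genSum w n ω - 1‖ₑ ^ q :=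
        ((hw.measurable_genSum n).sub_const 1).enorm.pow_const q
      have hm2 : Measurable fun ω => ‖Z ω - 1‖ₑ ^ q := (hZm.sub_const 1).enorm.pow_const q
      calc ∫⁻ ω, ‖genSum w n ω - Z ω‖ₑ ^ q ∂P
          ≤ ∫⁻ ω, 2 ^ (q - 1) * (‖genSum w n ω - 1‖ₑ ^ q + ‖Z ω - 1‖ₑ ^ q) ∂P := by
            refine lintegral_mono fun ω => ?_
            refine le_trans ?_ (ENNReal.rpow_add_le_mul_rpow_add_rpow _ _ h1q.le)
            refine ENNReal.rpow_le_rpow ?_ (by linarith)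
            have : genSum w n ω - Z ω = (genSum w n ω - 1) - (Z ω - 1) := by ring
            rw [this]
            exact enorm_sub_le
        _ = 2 ^ (q - 1) * (∫⁻ ω, ‖genSum w n ω - 1‖ₑ ^ q ∂P + ∫⁻ ω, ‖Z ω - 1‖ₑ ^ q ∂P) := by
            rw [lintegral_const_mul _ (by fun_prop), lintegral_add_left hm1]
        _ ≤ _ := by gcongr; exact hB1 n
  refine ⟨Z, hZ, fun p hp hpα => ?_, ?_⟩
  · obtain ⟨B, hB, hB1, hB2⟩ := hFatou p hp hpα
    refine ⟨fun n => hmem p hp _ (hw.measurable_genSum n) (ne_top_of_le_ne_top hB (hB1 n)),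
      hmem p hp Z hZm (ne_top_of_le_ne_top hB hB2), ?_⟩
    have h0 : ENNReal.ofReal p ≠ 0 := by simpa using hp
    simp_rw [eLpNorm_eq_lintegral_rpow_enorm_toReal h0 ENNReal.ofReal_ne_top,
      ENNReal.toReal_ofReal hp.le]
    have h1 := (ENNReal.continuous_rpow_const (y := 1 / p)).tendsto 0
    rw [ENNReal.zero_rpow_of_pos (by positivity)] at h1
    exact h1.comp (hconv p hp hpα)
  · rintro ⟨c, hc⟩
    -- Convergence in `L¹` closes the martingale: `Z` and `Z_1` have equal integrals over
    -- first-generation events. If `Z = c`, then `Z_1 = c` almost surely, and `c = 1` by the mean.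
    have hL1 : Tendsto (fun n => ∫⁻ ω, ‖genSum w n ω - Z ω‖ₑ ∂P) atTop (𝓝 0) := by
      simpa using hconv 1 one_pos hw.one_lt
    have hset : ∀ A, MeasurableSet[hw.filtration 1] A →
        ∫ ω in A, genSum w 1 ω ∂P = ∫ ω in A, c ∂P := by
      intro A hA
      have h1 : Tendsto (fun n => ∫ ω in A, genSum w n ω ∂P) atTop (𝓝 (∫ ω in A, Z ω ∂P)) :=
        tendsto_setIntegral_of_L1 Z hZm.aestronglyMeasurable
          (Eventually.of_forall hw.integrable_genSum) hL1 A
      have h2 : ∀ n, 1 ≤ n → ∫ ω in A, genSum w n ω ∂P = ∫ ω in A, genSum w 1 ω ∂P :=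
        fun n hn => (hw.martingale_genSum.setIntegral_eq hn hA).symm
      have h3 : Tendsto (fun n => ∫ ω in A, genSum w n ω ∂P) atTop
          (𝓝 (∫ ω in A, genSum w 1 ω ∂P)) :=
        tendsto_const_nhds.congr' (by
          filter_upwards [eventually_ge_atTop 1] with n hn
          exact (h2 n hn).symm)
      rw [tendsto_nhds_unique h3 h1]
      exact integral_congr_ae (ae_restrict_of_ae hc)
    have hae : genSum w 1 =ᵐ[P] fun _ => c :=
      ae_eq_of_forall_setIntegral_eq_of_sigmaFinite' (hw.filtration.le 1)
        (fun _ _ _ => (hw.integrable_genSum 1).integrableOn)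
        (fun _ _ _ => (integrable_const c).integrableOn) (fun A hA _ => hset A hA)
        (hw.measurable_genSum_filtration 1).stronglyMeasurable.aestronglyMeasurable
        aestronglyMeasurable_const
    have h0 : ∫ ω, genSum w 0 ω ∂P = ∫ ω, genSum w 1 ω ∂P := by
      simpa using hw.setIntegral_genSum_succ 0 (A := Set.univ) MeasurableSet.univ
    rw [integral_congr_ae hae] at h0
    simp only [genSum_zero, integral_const, probReal_univ, one_smul] at h0
    refine hnt ?_
    filter_upwards [hae] with ω hω
    rw [hω, ← h0]

end IsBoundaryCascade

end BRW

/-! ### Point measures, positive and negative parts, and the moment hypothesis. -/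

namespace BRW

lemma measurable_pairing {d : ℕ} (lam : CSpace d) : Measurable (pairing lam) := by
  have : Continuous (pairing lam) := by
    unfold pairing
    fun_prop
  exact this.measurable

lemma pairing_add {d : ℕ} (lam : CSpace d) (x y : RSpace d) :
    pairing lam (x + y) = pairing lam x + pairing lam y := by
  simp [pairing, mul_add, Finset.sum_add_distrib]

lemma pairing_zero {d : ℕ} (lam : CSpace d) : pairing lam 0 = 0 := by
  simp [pairing]

open Classical in
lemma lintegral_pointMeasure {d : ℕ} (N : ℕ∞) (x : ℕ → RSpace d) {f : RSpace d → ℝ≥0∞}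
    (hf : Measurable f) :
    ∫⁻ y, f y ∂(pointMeasure N x) = ∑' j : ℕ, if (j : ℕ∞) < N then f (x j) else 0 := by
  rw [pointMeasure, lintegral_sum_measure]
  simp_rw [lintegral_dirac' _ hf]
  refine (tsum_subtype {j : ℕ | (j : ℕ∞) < N} fun j => f (x j)).trans (tsum_congr fun j => ?_)
  by_cases h : (j : ℕ∞) < N
  · rw [Set.indicator_of_mem (by exact h), if_pos h]
  · rw [Set.indicator_of_notMem (by exact h), if_neg h]

lemma tsum_eq_toReal_sub {s : ℕ → ℝ} (hs : Summable s) :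
    ∑' j, s j = (∑' j, ENNReal.ofReal (s j)).toReal - (∑' j, ENNReal.ofReal (-s j)).toReal := by
  rw [ENNReal.tsum_toReal_eq (fun _ => ENNReal.ofReal_ne_top),
    ENNReal.tsum_toReal_eq (fun _ => ENNReal.ofReal_ne_top)]
  simp_rw [ENNReal.toReal_ofReal']
  have h1 : Summable fun j => max (s j) 0 := hs.norm.of_nonneg_of_le (fun _ => le_max_right _ _)
    fun j => max_le (le_abs_self _) (abs_nonneg _)
  have h2 : Summable fun j => max (-s j) 0 := hs.norm.of_nonneg_of_le (fun _ => le_max_right _ _)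
    fun j => max_le (neg_le_abs _) (abs_nonneg _)
  rw [← h1.tsum_sub h2]
  refine tsum_congr fun j => ?_
  rcases le_total (s j) 0 with h | h
  · rw [max_eq_right h, max_eq_left (by linarith)]; ring
  · rw [max_eq_left h, max_eq_right (by linarith)]; ring

lemma genSum_one {Ω : Type*} (w : List ℕ → ℕ → Ω → ℂ) (ω : Ω) : genSum w 1 ω = total w [] ω := by
  have : Unique (Gen 0) := ⟨⟨⟨[], rfl⟩⟩, genZero_default⟩
  rw [genSum, ← (genSuccEquiv 0).tsum_eq, ← (Equiv.uniqueProd ℕ (Gen 0)).symm.tsum_eq]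
  refine tsum_congr fun j => ?_
  change node id w (j :: (default : Gen 0).1) ω = _
  rw [genZero_default default]
  simp [node]

/-- The threshold is `‖y‖ = 3 > e`: above it `log ‖y‖ ≥ 1`, so `1 + log (2 ‖y‖) ≤ 3 log ‖y‖`, whence
the `9`, and the square is at most the power `2 + ε`. Below it, `‖y - 1‖ ≤ 4`. -/
lemma logMomentFun_sub_one_le {α ε : ℝ} (hα : 0 < α) (hε : 0 < ε) (y : ℂ) :
    logMomentFun α (y - 1) ≤ ENNReal.ofReal (4 ^ α * (1 + Real.log 4) ^ 2) +
      ENNReal.ofReal (2 ^ α * 9) *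
        ENNReal.ofReal (‖y‖ ^ α * (max (Real.log ‖y‖) 0) ^ (2 + ε)) := by
  have hr : ‖y - 1‖ ≤ ‖y‖ + 1 := (norm_sub_le _ _).trans (by simp)
  have hr0 := norm_nonneg (y - 1)
  have hmax : ∀ b : ℝ, 1 ≤ b → ‖y - 1‖ ≤ b → max (Real.log ‖y - 1‖) 0 ≤ Real.log b := by
    intro b hb hle
    refine max_le ?_ (Real.log_nonneg hb)
    rcases hr0.eq_or_lt with h | h
    · rw [← h, Real.log_zero]; exact Real.log_nonneg hb
    · exact Real.log_le_log h hle
  have hmax0 : 0 ≤ max (Real.log ‖y - 1‖) 0 := le_max_right _ _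
  rcases le_total ‖y‖ 3 with h | h
  · refine le_trans (ENNReal.ofReal_le_ofReal ?_) le_self_add
    have h4 : ‖y - 1‖ ≤ 4 := by linarith
    have := hmax 4 (by norm_num) h4
    gcongr
  · refine le_trans ?_ le_add_self
    rw [← ENNReal.ofReal_mul (by positivity)]
    refine ENNReal.ofReal_le_ofReal ?_
    have h2 : ‖y - 1‖ ≤ 2 * ‖y‖ := by linarith
    have hlog1 : 1 ≤ Real.log ‖y‖ := by
      rw [Real.le_log_iff_exp_le (by linarith)]
      linarith [Real.exp_one_lt_d9]
    have h5 := hmax (2 * ‖y‖) (by linarith) h2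
    rw [Real.log_mul (by norm_num) (by linarith)] at h5
    have hlog2 : Real.log 2 ≤ 1 := by linarith [Real.log_two_lt_d9]
    have h6 : 1 + max (Real.log ‖y - 1‖) 0 ≤ 3 * Real.log ‖y‖ := by linarith
    have h7 : Real.log ‖y‖ ^ 2 ≤ Real.log ‖y‖ ^ (2 + ε) := by
      rw [← Real.rpow_natCast]
      exact Real.rpow_le_rpow_of_exponent_le hlog1 (by push_cast; linarith)
    rw [max_eq_left (by linarith : (0 : ℝ) ≤ Real.log ‖y‖)]
    calc ‖y - 1‖ ^ α * (1 + max (Real.log ‖y - 1‖) 0) ^ 2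
        ≤ (2 * ‖y‖) ^ α * (3 * Real.log ‖y‖) ^ 2 := by gcongr
      _ = 2 ^ α * 9 * (‖y‖ ^ α * Real.log ‖y‖ ^ 2) := by
          rw [Real.mul_rpow (by norm_num) (norm_nonneg _)]; ring
      _ ≤ _ := by gcongr

end BRW

/-! ### The branching random walk as a boundary cascade. -/

namespace BranchingRandomWalk

open BRW

variable {d : ℕ} {Ω : Type*} [MeasurableSpace Ω] {P : Measure Ω}

/-- The factor by which the weight changes along an edge with displacement `x`. -/
noncomputable def stepWeight (B : BranchingRandomWalk d P) (lam : CSpace d) (x : RSpace d) : ℂ :=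
  (B.laplace lam)⁻¹ * Complex.exp (-pairing lam x)

open Classical in
/-- The weight attached to the edge from `u` to its `j`-th child, zero if there is no such child. -/
noncomputable def edgeWeight (B : BranchingRandomWalk d P) (lam : CSpace d) (u : List ℕ) (j : ℕ)
    (ω : Ω) : ℂ :=
  if (j : ℕ∞) < B.N u ω then B.stepWeight lam (B.X u j ω) else 0

variable (B : BranchingRandomWalk d P) (lam : CSpace d)

lemma measurable_stepWeight : Measurable (B.stepWeight lam) :=
  (Complex.measurable_exp.comp (measurable_pairing lam).neg).const_mul _

lemma length_of_mem_generation {n : ℕ} {ω : Ω} {u : List ℕ} (hu : u ∈ B.generation n ω) :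
    u.length = n := by
  induction n generalizing u with
  | zero => rw [generation, Set.mem_singleton_iff] at hu; simp [hu]
  | succ n ih =>
    obtain ⟨v, hv, j, -, rfl⟩ := hu
    simp [ih hv]

lemma cons_mem_generation {n : ℕ} {ω : Ω} {u : List ℕ} {j : ℕ} :
    j :: u ∈ B.generation (n + 1) ω ↔ u ∈ B.generation n ω ∧ (j : ℕ∞) < B.N u ω := by
  constructor
  · rintro ⟨v, hv, i, hi, h⟩
    obtain ⟨rfl, rfl⟩ := List.cons_eq_cons.1 h
    exact ⟨hv, hi⟩
  · rintro ⟨h1, h2⟩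
    exact ⟨u, h1, j, h2, rfl⟩

open Classical in
lemma node_edgeWeight (u : List ℕ) (ω : Ω) :
    node id (B.edgeWeight lam) u ω =
      if u ∈ B.generation u.length ω then B.weight lam u ω else 0 := by
  induction u with
  | nil => simp [node, generation, weight, position, pairing_zero]
  | cons j u ih =>
    rw [node, ih, List.length_cons]
    simp only [cons_mem_generation, id]
    by_cases h1 : u ∈ B.generation u.length ω
    · by_cases h2 : (j : ℕ∞) < B.N u ω
      · rw [if_pos h1, if_pos ⟨h1, h2⟩, edgeWeight, if_pos h2, stepWeight, weight, weight, position,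
          pairing_add, neg_add, Complex.exp_add, List.length_cons, pow_succ, mul_inv]
        ring
      · rw [if_neg (fun h : _ ∧ _ => h2 h.2), edgeWeight, if_neg h2, mul_zero]
    · rw [if_neg h1, if_neg (fun h => h1 h.1), zero_mul]

/-- Absent words have weight `0` in the cascade, so the random index set can be replaced by all
words of length `n`. -/
lemma tsum_generation {E : Type*} [AddCommMonoid E] [TopologicalSpace E] [T2Space E] (F : ℂ → E)
    (hF : F 0 = 0) (n : ℕ) (ω : Ω) :
    ∑' u : B.generation n ω, F (B.weight lam u ω) =
      ∑' u : Gen n, F (node id (B.edgeWeight lam) u ω) := by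
  classical
  rw [tsum_subtype (B.generation n ω) fun u => F (B.weight lam u ω)]
  refine Eq.trans ?_ (tsum_subtype {u : List ℕ | u.length = n}
    fun u => F (node id (B.edgeWeight lam) u ω)).symm
  refine tsum_congr fun u => ?_
  by_cases hu : u ∈ B.generation n ω
  · have hlen := B.length_of_mem_generation hu
    rw [Set.indicator_of_mem hu, Set.indicator_of_mem (by exact hlen), node_edgeWeight,
      if_pos (by rwa [hlen])]
  · rw [Set.indicator_of_notMem hu]
    by_cases hlen : u.length = n
    · rw [Set.indicator_of_mem (by exact hlen), node_edgeWeight, if_neg (by rwa [hlen]), hF]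
    · rw [Set.indicator_of_notMem (by exact hlen)]

lemma additive_eq_genSum (n : ℕ) (ω : Ω) :
    B.additive lam n ω = genSum (B.edgeWeight lam) n ω := by
  rw [genSum, ← B.tsum_generation lam (fun z => z) rfl, additive, ← tsum_mul_left]
  refine tsum_congr fun u => ?_
  rw [weight, B.length_of_mem_generation u.2]

lemma tsum_generation_one {F : ℂ → ℝ≥0∞} (hF : F 0 = 0) (ω : Ω) :
    ∑' u : B.generation 1 ω, F (B.weight lam u ω) = ∑' j, F (B.edgeWeight lam [] j ω) := by
  rw [B.tsum_generation lam F hF, tsum_gen_succ 0 fun u => F (node id (B.edgeWeight lam) u ω),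
    tsum_gen_zero fun u => ∑' j, F (node id (B.edgeWeight lam) (j :: u) ω)]
  simp [node]

lemma measurable_edgeWeight (u : List ℕ) (j : ℕ) : Measurable (B.edgeWeight lam u j) :=
  Measurable.ite (B.measurable_N u (MeasurableSet.of_discrete (s := {n : ℕ∞ | (j : ℕ∞) < n})))
    ((B.measurable_stepWeight lam).comp (B.measurable_X u j)) measurable_const

lemma lintegral_offspring (u : List ℕ) (ω : Ω) {F : ℂ → ℝ≥0∞} (hF : Measurable F) (hF0 : F 0 = 0) :
    ∫⁻ x, F (B.stepWeight lam x) ∂(B.offspring u ω) = ∑' j, F (B.edgeWeight lam u j ω) := by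
  classical
  have hm : Measurable fun x => F (B.stepWeight lam x) := hF.comp (B.measurable_stepWeight lam)
  rw [offspring, lintegral_pointMeasure _ _ hm]
  refine tsum_congr fun j => ?_
  rw [edgeWeight]
  split_ifs with h
  · rfl
  · exact hF0.symm

lemma lintegral_intensity {F : ℂ → ℝ≥0∞} (hF : Measurable F) (hF0 : F 0 = 0) :
    ∫⁻ x, F (B.stepWeight lam x) ∂B.intensity = ∫⁻ ω, ∑' j, F (B.edgeWeight lam [] j ω) ∂P := by
  have hm : Measurable fun x => F (B.stepWeight lam x) := hF.comp (B.measurable_stepWeight lam)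
  refine (Measure.lintegral_bind (B.identDistrib []).aemeasurable_fst hm.aemeasurable).trans ?_
  exact lintegral_congr fun ω => B.lintegral_offspring lam [] ω hF hF0

lemma lintegral_edgeWeight (u : List ℕ) {F : ℂ → ℝ≥0∞} (hF : Measurable F) (hF0 : F 0 = 0) :
    ∫⁻ ω, ∑' j, F (B.edgeWeight lam u j ω) ∂P =
      ∫⁻ ω, ∑' j, F (B.edgeWeight lam [] j ω) ∂P := by
  simp_rw [← fun u ω => B.lintegral_offspring lam u ω hF hF0]
  exact ((B.identDistrib u).comp
    (Measure.measurable_lintegral (hF.comp (B.measurable_stepWeight lam)))).lintegral_eq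

lemma iIndepFun_edgeWeight :
    iIndepFun (fun (u : List ℕ) (ω : Ω) (j : ℕ) => B.edgeWeight lam u j ω) P := by
  classical
  refine B.indep.comp (fun _ p (j : ℕ) => if (j : ℕ∞) < p.1 then B.stepWeight lam (p.2 j) else 0)
    fun _ => measurable_pi_lambda _ fun j => ?_
  exact Measurable.ite (measurable_fst (MeasurableSet.of_discrete (s := {n : ℕ∞ | (j : ℕ∞) < n})))
    ((B.measurable_stepWeight lam).comp ((measurable_pi_apply j).comp measurable_snd))
    measurable_const

/-- The integral of the step weight against a measure, in a form that is measurable in the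
measure. -/
noncomputable def stepIntegral (ρ : Measure (RSpace d)) : ℂ :=
  (((∫⁻ x, ENNReal.ofReal (B.stepWeight lam x).re ∂ρ).toReal -
    (∫⁻ x, ENNReal.ofReal (-(B.stepWeight lam x).re) ∂ρ).toReal : ℝ) : ℂ) +
  (((∫⁻ x, ENNReal.ofReal (B.stepWeight lam x).im ∂ρ).toReal -
    (∫⁻ x, ENNReal.ofReal (-(B.stepWeight lam x).im) ∂ρ).toReal : ℝ) : ℂ) * Complex.I

lemma measurable_stepIntegral : Measurable (B.stepIntegral lam) := by
  have h : ∀ f : ℂ → ℝ, Measurable f → Measurable fun ρ : Measure (RSpace d) =>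
      (∫⁻ x, ENNReal.ofReal (f (B.stepWeight lam x)) ∂ρ).toReal := fun f hf =>
    (Measure.measurable_lintegral
      (hf.comp (B.measurable_stepWeight lam)).ennreal_ofReal).ennreal_toReal
  have hre := Complex.measurable_re
  have him := Complex.measurable_im
  exact (Complex.measurable_ofReal.comp ((h _ hre).sub (h _ hre.neg))).add
    ((Complex.measurable_ofReal.comp ((h _ him).sub (h _ him.neg))).mul_const _)

/-- Only the point processes, not their enumerations, are identically distributed, so the row sum
must be expressed as a measurable function of the point process. -/
lemma tsum_edgeWeight_eq (u : List ℕ) {ω : Ω} (hs : Summable fun j => B.edgeWeight lam u j ω) :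
    ∑' j, B.edgeWeight lam u j ω = B.stepIntegral lam (B.offspring u ω) := by
  have hre := Complex.measurable_re
  have him := Complex.measurable_im
  have hsre : Summable fun j => (B.edgeWeight lam u j ω).re := Complex.reCLM.summable hs
  have hsim : Summable fun j => (B.edgeWeight lam u j ω).im := Complex.imCLM.summable hs
  rw [stepIntegral,
    B.lintegral_offspring lam u ω (F := fun z => ENNReal.ofReal z.re) hre.ennreal_ofReal (by simp),
    B.lintegral_offspring lam u ω (F := fun z => ENNReal.ofReal (-z.re)) hre.neg.ennreal_ofReal
      (by simp),
    B.lintegral_offspring lam u ω (F := fun z => ENNReal.ofReal z.im) him.ennreal_ofReal (by simp),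
    B.lintegral_offspring lam u ω (F := fun z => ENNReal.ofReal (-z.im)) him.neg.ennreal_ofReal
      (by simp), ← tsum_eq_toReal_sub hsre,
    ← tsum_eq_toReal_sub hsim]
  rw [← Complex.re_add_im (∑' j, B.edgeWeight lam u j ω), Complex.re_tsum hs, Complex.im_tsum hs]

variable {B lam}

lemma integrable_stepWeight (hlam : lam ∈ B.domain) : Integrable (B.stepWeight lam) B.intensity :=
  Integrable.const_mul hlam _

lemma lintegral_enorm_edgeWeight_ne_top (hlam : lam ∈ B.domain) (u : List ℕ) :
    ∫⁻ ω, ∑' j, ‖B.edgeWeight lam u j ω‖ₑ ∂P ≠ ∞ := by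
  rw [B.lintegral_edgeWeight lam u (F := fun z => ‖z‖ₑ) measurable_enorm (by simp),
    ← B.lintegral_intensity lam (F := fun z => ‖z‖ₑ) measurable_enorm (by simp)]
  exact (integrable_stepWeight hlam).hasFiniteIntegral.ne

lemma ae_summable_edgeWeight (hlam : lam ∈ B.domain) (u : List ℕ) :
    ∀ᵐ ω ∂P, Summable fun j => B.edgeWeight lam u j ω := by
  refine ae_summable_of_tsum_lintegral (fun j => B.measurable_edgeWeight lam u j) ?_
  rw [← lintegral_tsum fun j => (B.measurable_edgeWeight lam u j).enorm.aemeasurable]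
  exact lintegral_enorm_edgeWeight_ne_top hlam u

lemma isCascade (hlam : lam ∈ B.domain) : IsCascade P (B.edgeWeight lam) where
  measurable := B.measurable_edgeWeight lam
  indep := B.iIndepFun_edgeWeight lam
  lintegral_eq u _ hF hF0 := B.lintegral_edgeWeight lam u hF hF0
  identDistrib u := by
    have hae : ∀ v : List ℕ, (fun ω => ∑' j, B.edgeWeight lam v j ω) =ᵐ[P]
        fun ω => B.stepIntegral lam (B.offspring v ω) := fun v => by
      filter_upwards [ae_summable_edgeWeight hlam v] with ω hω
      exact B.tsum_edgeWeight_eq lam v hω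
    have hm : ∀ v : List ℕ, AEMeasurable (fun ω => ∑' j, B.edgeWeight lam v j ω) P := fun v =>
      (measurable_tsum_of_countable fun j => B.measurable_edgeWeight lam v j).aemeasurable
    exact ((IdentDistrib.of_ae_eq (hm u) (hae u)).trans
      ((B.identDistrib u).comp (B.measurable_stepIntegral lam))).trans
      (IdentDistrib.of_ae_eq (hm []) (hae [])).symm

/-- Splitting the intensity by child label allows the Laplace transform, a complex integral, to be
compared term by term with the mean of the row sum. -/
lemma intensity_eq_sum (B : BranchingRandomWalk d P) :
    B.intensity = Measure.sum fun j : ℕ =>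
      (P.restrict {ω | (j : ℕ∞) < B.N [] ω}).map (B.X [] j) := by
  classical
  have hNm : ∀ j : ℕ, MeasurableSet {ω | (j : ℕ∞) < B.N [] ω} := fun j =>
    B.measurable_N [] (MeasurableSet.of_discrete (s := {n : ℕ∞ | (j : ℕ∞) < n}))
  ext A hA
  rw [B.intensity_apply hA, Measure.sum_apply _ hA]
  have h1 : ∀ ω, B.offspring [] ω A =
      ∑' j : ℕ, ({ω | (j : ℕ∞) < B.N [] ω} ∩ B.X [] j ⁻¹' A).indicator (1 : Ω → ℝ≥0∞) ω := by
    intro ω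
    rw [← lintegral_indicator_one hA, offspring,
      lintegral_pointMeasure _ _ (measurable_one.indicator hA)]
    refine tsum_congr fun j => ?_
    by_cases h1 : (j : ℕ∞) < B.N [] ω <;> by_cases h2 : B.X [] j ω ∈ A <;>
      simp [Set.indicator, h1, h2]
  simp_rw [h1]
  rw [lintegral_tsum fun j => (measurable_one.indicator
    ((hNm j).inter (B.measurable_X [] j hA))).aemeasurable]
  refine tsum_congr fun j => ?_
  rw [lintegral_indicator_one ((hNm j).inter (B.measurable_X [] j hA)),
    Measure.map_apply (B.measurable_X [] j) hA, Measure.restrict_apply (B.measurable_X [] j hA),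
    Set.inter_comm]

lemma integral_total_edgeWeight (hlam : lam ∈ B.domain) (hm : B.laplace lam ≠ 0) :
    ∫ ω, total (B.edgeWeight lam) [] ω ∂P = 1 := by
  have hNm : ∀ j : ℕ, MeasurableSet {ω | (j : ℕ∞) < B.N [] ω} := fun j =>
    B.measurable_N [] (MeasurableSet.of_discrete (s := {n : ℕ∞ | (j : ℕ∞) < n}))
  have h1 : ∫ x, B.stepWeight lam x ∂B.intensity = 1 := by
    simp only [stepWeight]
    rw [integral_const_mul]
    exact inv_mul_cancel₀ hm
  have hint := integrable_stepWeight hlam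
  rw [intensity_eq_sum] at h1 hint
  rw [← h1, ← (hasSum_integral_measure hint).tsum_eq]
  simp only [total]
  rw [integral_tsum fun j => (B.measurable_edgeWeight lam [] j).aestronglyMeasurable]
  · refine tsum_congr fun j => ?_
    rw [integral_map (B.measurable_X [] j).aemeasurable
      (B.measurable_stepWeight lam).aestronglyMeasurable, ← integral_indicator (hNm j)]
    refine integral_congr_ae (Eventually.of_forall fun ω => ?_)
    by_cases h : (j : ℕ∞) < B.N [] ω <;> simp [edgeWeight, Set.indicator, h]
  · rw [← lintegral_tsum fun j => (B.measurable_edgeWeight lam [] j).enorm.aemeasurable]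
    exact lintegral_enorm_edgeWeight_ne_top hlam []

/-- Otherwise almost surely every present weight has modulus at least 1. The negative part of the
logarithmic mean is then zero, hence so is the positive part, and all moduli equal 1. The sum of
their `α`-th powers then counts the children, so the mean number of children is 1, against
supercriticality. -/
lemma stepLaw_Ioi_ne_zero (hsuper : 1 < B.intensity Set.univ) (hlam : lam ∈ B.domain)
    (hm : B.laplace lam ≠ 0) {α : ℝ} (hα : 0 < α) (hC1 : B.CharacteristicIndex lam α) :
    stepLaw P (B.edgeWeight lam) α (Set.Ioi 0) ≠ 0 := by
  classical
  intro h0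
  have hlogm : Measurable fun z : ℂ => Real.log ‖z‖ := Real.measurable_log.comp measurable_norm
  have hFp : Measurable fun z : ℂ => ENNReal.ofReal (‖z‖ ^ α * max (Real.log ‖z‖) 0) :=
    ((measurable_norm.pow_const α).mul (hlogm.max measurable_const)).ennreal_ofReal
  obtain ⟨h1, -, h2⟩ := hC1
  rw [lintegral_congr fun ω => B.tsum_generation_one lam
    (F := fun z => ENNReal.ofReal (‖z‖ ^ α)) (by simp [Real.zero_rpow hα.ne']) ω] at h1
  rw [lintegral_congr fun ω => B.tsum_generation_one lam
      (F := fun z => ENNReal.ofReal (‖z‖ ^ α * max (Real.log ‖z‖) 0)) (by simp) ω,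
    lintegral_congr fun ω => B.tsum_generation_one lam
      (F := fun z => ENNReal.ofReal (‖z‖ ^ α * max (-Real.log ‖z‖) 0)) (by simp) ω] at h2
  set w := B.edgeWeight lam with hw
  have hwm : ∀ j, Measurable (w [] j) := B.measurable_edgeWeight lam []
  have hae1 : ∀ᵐ ω ∂P, ∀ j, w [] j ω ≠ 0 → 0 ≤ Real.log ‖w [] j ω‖ := by
    rw [(isCascade hlam).stepLaw_apply α measurableSet_Ioi, lintegral_eq_zero_iff] at h0
    · filter_upwards [h0] with ω hω j hj
      have h3 := ENNReal.tsum_eq_zero.1 hω j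
      by_contra! hlt
      rw [Set.indicator_of_mem (by simpa using hlt)] at h3
      simp only [Pi.one_apply, mul_one] at h3
      simp [hα.not_gt, enorm_eq_zero] at h3
      exact hj h3.1
    · exact Measurable.tsum fun j => ((hwm j).enorm.pow_const α).mul
        ((measurable_one.indicator measurableSet_Ioi).comp (hlogm.comp (hwm j)).neg)
  have hneg : ∫⁻ ω, ∑' j, ENNReal.ofReal (‖w [] j ω‖ ^ α * max (-Real.log ‖w [] j ω‖) 0) ∂P = 0 := by
    rw [← lintegral_zero (μ := P)]
    refine lintegral_congr_ae ?_
    filter_upwards [hae1] with ω hω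
    rw [ENNReal.tsum_eq_zero]
    intro j
    rcases eq_or_ne (w [] j ω) 0 with h | h
    · simp [h]
    · rw [max_eq_right (by linarith [hω j h])]
      simp
  have hsum : Measurable fun ω =>
      ∑' j, ENNReal.ofReal (‖w [] j ω‖ ^ α * max (Real.log ‖w [] j ω‖) 0) :=
    Measurable.tsum fun j => hFp.comp (hwm j)
  rw [hneg, nonpos_iff_eq_zero, lintegral_eq_zero_iff hsum] at h2
  have hae2 : ∀ᵐ ω ∂P, ∑' j, ENNReal.ofReal (‖w [] j ω‖ ^ α) =
      ∑' j, (if w [] j ω = 0 then 0 else 1) := by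
    filter_upwards [hae1, h2] with ω hω hω2
    refine tsum_congr fun j => ?_
    split_ifs with hj
    · simp [hj, hα.ne']
    · have hpos : 0 < ‖w [] j ω‖ := norm_pos_iff.2 hj
      have h3 := ENNReal.tsum_eq_zero.1 hω2 j
      rw [ENNReal.ofReal_eq_zero] at h3
      have h4 : max (Real.log ‖w [] j ω‖) 0 ≤ 0 := by
        by_contra! h5
        have : 0 < ‖w [] j ω‖ ^ α * max (Real.log ‖w [] j ω‖) 0 := by positivity
        exact absurd h3 (not_le.2 this)
      have h5 : Real.log ‖w [] j ω‖ = 0 :=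
        le_antisymm ((le_max_left _ _).trans h4) (hω j hj)
      rw [Real.eq_one_of_pos_of_log_eq_zero hpos h5]
      simp
  rw [lintegral_congr_ae hae2] at h1
  -- Since step weights never vanish, this indicator counts all children and its integral is the
  -- total mass of the intensity.
  have h6 := B.lintegral_intensity lam (F := fun z => if z = 0 then 0 else 1)
    (Measurable.ite (measurableSet_singleton 0) measurable_const measurable_const) (by simp)
  rw [h1] at h6
  have h7 : ∀ x, B.stepWeight lam x ≠ 0 := fun x => by simp [stepWeight, hm]
  simp only [h7, if_false, lintegral_const, one_mul] at h6
  exact absurd h6 hsuper.ne'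

lemma isBoundaryCascade (hsuper : 1 < B.intensity Set.univ) (hlam : lam ∈ B.domain)
    (hm : B.laplace lam ≠ 0) {α : ℝ} (hα : α ∈ Set.Ioo (1 : ℝ) 2)
    (hC1 : B.CharacteristicIndex lam α) (hC2 : B.LogMoment lam α) [IsProbabilityMeasure P] :
    IsBoundaryCascade P (B.edgeWeight lam) α where
  toIsCascade := isCascade hlam
  one_lt := hα.1
  lt_two := hα.2
  lintegral_rpow := by
    have hα0 : 0 < α := by linarith [hα.1]
    rw [← hC1.1]
    refine lintegral_congr fun ω => ?_
    rw [B.tsum_generation_one lam (F := fun z => ENNReal.ofReal (‖z‖ ^ α)) (by simp [Real.zero_rpow hα0.ne'])]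
    refine tsum_congr fun j => ?_
    rw [← ofReal_norm, ENNReal.ofReal_rpow_of_nonneg (norm_nonneg _) hα0.le]
  lintegral_enorm := lintegral_enorm_edgeWeight_ne_top hlam []
  integral_total := integral_total_edgeWeight hlam hm
  lintegral_logMoment := by
    obtain ⟨ε, hε, h⟩ := hC2
    simp_rw [B.additive_eq_genSum, genSum_one] at h
    refine ne_top_of_le_ne_top ?_ (lintegral_mono fun ω =>
      logMomentFun_sub_one_le (by linarith [hα.1]) hε (total (B.edgeWeight lam) [] ω))
    rw [lintegral_add_left measurable_const, lintegral_const_mul' _ _ ENNReal.ofReal_ne_top]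
    refine ENNReal.add_ne_top.2 ⟨by simp, ENNReal.mul_ne_top ENNReal.ofReal_ne_top h.ne⟩
  stepLaw_pos := stepLaw_Ioi_ne_zero hsuper hlam hm (by linarith [hα.1]) hC1

end BranchingRandomWalk

theorem mainTheorem1 {d : ℕ} (hd : 1 ≤ d) {Ω : Type*} [MeasurableSpace Ω] {P : Measure Ω}
    [IsProbabilityMeasure P] (B : BranchingRandomWalk d P)
    (hsuper : 1 < B.intensity Set.univ)
    (hint : (interior B.domain).Nonempty)
    (lam : BRW.CSpace d) (hlam : lam ∈ B.domain) (hm : B.laplace lam ≠ 0)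
    (hnontriv : ¬ ∀ᵐ ω ∂P, B.additive lam 1 ω = 1)
    (α : ℝ) (hα : α ∈ Set.Ioo (1 : ℝ) 2)
    (hC1 : B.CharacteristicIndex lam α) (hC2 : B.LogMoment lam α) :
    ∃ Z : Ω → ℂ,
      (∀ᵐ ω ∂P, Tendsto (fun n => B.additive lam n ω) atTop (𝓝 (Z ω))) ∧
      (∀ p : ℝ, 0 < p → p < α →
        (∀ n, MemLp (B.additive lam n) (ENNReal.ofReal p) P) ∧
        MemLp Z (ENNReal.ofReal p) P ∧
        Tendsto (fun n => eLpNorm (fun ω => B.additive lam n ω - Z ω) (ENNReal.ofReal p) P)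
          atTop (𝓝 0)) ∧
      ¬ ∃ c : ℂ, ∀ᵐ ω ∂P, Z ω = c := by
  have hB := BranchingRandomWalk.isBoundaryCascade hsuper hlam hm hα hC1 hC2
  have h := B.additive_eq_genSum lam
  have h' : ∀ n, B.additive lam n = BRW.genSum (B.edgeWeight lam) n := fun n => funext (h n)
  simp_rw [h'] at hnontriv ⊢
  exact hB.exists_limit hnontriv
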